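/- Let $K$ be a field, let $n\ge 2$, and let $\mathbb X\subseteq\mathbb P^n_K$ be a non-empty reduced 0-dimensional closed subscheme with saturated homogeneous vanishing ideal $I_{\mathbb X}\subseteq P=K[X_0,\dots,X_n]$ and homogeneous coordinate ring $R=P/I_{\mathbb X}$. Let $x_i$ be the image of $X_i$ in $R$, and let $\deg(\mathbb X)=\dim_K S$ where $S=R/\langle x_0-1\rangle$. Assume that $\operatorname{char}(K)=0$ or $\operatorname{char}(K)>\deg(\mathbb X)$, and that no closed point of $\mathbb X$ lies on the hyperplane $X_0=0$, so that $\mathbb X\cong\operatorname{Spec} S$. For $i\in\mathbb Z$ let $\operatorname{HF}_{\mathbb X}(i)=\dim_K R_i$, and for a homogeneous ideal $\mathfrak a$ of $R$ let $\operatorname{HF}_{\mathfrak a}(i)=\dim_K \mathfrak a_i$. Let $r_{\mathbb X}$ be the regularity index of $\operatorname{HF}_{\mathbb X}$, i.e. the least $i\in\mathbb Z$ such that $\operatorname{HF}_{\mathbb X}(j)$ equals the Hilbert polynomial at $j$ for all $j\ge i$, and let $\alpha_{\mathbb X}=\min\{i\in\mathbb N\mid (I_{\mathbb X})_i\ne 0\}$.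 The scheme $\mathbb X$ is in generic position if $\operatorname{HF}_{\mathbb X}(i)=\min\{\deg(\mathbb X),\binom{n+i}{n}\}$ for all $i\in\mathbb Z$ (where $\binom{n+i}{n}=0$ for $i<0$). The Kähler different $\vartheta_{\mathbb X}$ is the initial Fitting ideal $F_0(\Omega^1_{R/K[x_0]})$, an ideal of $R$. Let $\widetilde R=S[x_0]$ (with $x_0$ regarded as an indeterminate over $S$), which contains $R$ via $f\mapsto f^{\mathrm{deh}}x_0^i$ for $f\in R_i$, where $f^{\mathrm{deh}}$ is the image of $f$ in $S$, and let $\mathfrak F_{\widetilde R/R}=\{f\in R\mid f\widetilde R\subseteq R\}$ be the conductor. Let $p_1,\dots,p_s$ be the closed points of $\mathbb X$, so that $S\cong\prod_{j}\mathcal O_{\mathbb X,p_j}$, and let $\kappa_j=\dim_K K(p_j)$ where $K(p_j)$ is the residue field. A maximal $p_j$-subscheme is a closed (possibly empty) subscheme $\mathbb Y\subseteq\mathbb X$ with $\mathcal O_{\mathbb Y,p_j}\ne\mathcal O_{\mathbb X,p_j}$, $\mathcal O_{\mathbb Y,p_k}=\mathcal O_{\mathbb X,p_k}$ for $k\ne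 j$, and $\deg(\mathbb Y)=\deg(\mathbb X)-\kappa_j$. Its ideal in $S$ is generated by a tuple $(0,\dots,0,s_j,0,\dots,0)$ with $s_j\in\mathcal O_{\mathbb X,p_j}$. Let $e_{j1},\dots,e_{j\kappa_j}\in\mathcal O_{\mathbb X,p_j}$ have residue classes which form a $K$-basis of $K(p_j)$. Put $\mu_{\mathbb Y/\mathbb X}=\max_k\mu(e_{jk}s_j)$, where $\mu(a)=\min\{i\in\mathbb N\mid(0,\dots,0,a,0,\dots,0)x_0^i\in R\}$; this does not depend on the choices. The degree of $p_j$ in $\mathbb X$ is the minimum of $\mu_{\mathbb Y/\mathbb X}$ over all maximal $p_j$-subschemes $\mathbb Y$, and $\mathbb X$ is a CB-scheme (Cayley-Bacharach scheme) if the degree of every $p_j$ in $\mathbb X$ is $r_{\mathbb X}$. Then the following conditions are equivalent. (a) $\mathbb X$ is in generic position with $\deg(\mathbb X)=\binom{n+\alpha_{\mathbb X}-1}{n}$. (b) $\operatorname{HF}_{\vartheta_{\mathbb X}}(i)=0$ for $i<nr_{\mathbb X}$ and $\operatorname{HF}_{\vartheta_{\mathbb X}}(i)=\deg(\mathbb X)$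 for $i\ge nr_{\mathbb X}$. (c) $\mathbb X$ is a CB-scheme and $\vartheta_{\mathbb X}=\mathfrak F_{\widetilde R/R}^{\,n}$. -/

import Mathlib

open MvPolynomial Filter

noncomputable section

/-! ### Initial Fitting ideal -/

/-- The initial Fitting ideal `F₀(M)` of a finitely generated module: the ideal generated by the
determinants of all square matrices whose rows are relations of a finite generating system of `M`.
(For each single generating system these determinants generate the same ideal, so it does not
matter that all generating systems are allowed here.) -/
def initialFittingIdeal (A : Type*) [CommRing A] (M : Type*) [AddCommGroup M] [Module A M] :
    Ideal A :=
  Ideal.span {d : A | ∃ (k : ℕ) (m : Fin k → M) (B : Matrix (Fin k) (Fin k) A),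
    Submodule.span A (Set.range m) = ⊤ ∧ (∀ i, ∑ j, B i j • m j = 0) ∧ d = B.det}

/-! ### Regularity index -/

/-- The regularity index of a function `h : ℤ → ℕ` of polynomial type: the least `i` such that
`h` agrees with its Hilbert polynomial (the polynomial with which it agrees in all large degrees)
in all degrees `j ≥ i`. -/
def regularityIndex (h : ℤ → ℕ) : ℤ :=
  sInf {i : ℤ | ∃ p : Polynomial ℚ, ∀ j : ℤ, i ≤ j → (h j : ℚ) = p.eval (j : ℚ)}

/-! ### 0-dimensional subschemes of projective space -/

section

attribute [local instance] MvPolynomial.gradedAlgebra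

/-- A non-empty 0-dimensional closed subscheme of `ℙⁿ` over `K`, given by its homogeneous
vanishing ideal: a homogeneous ideal of `K[X₀, …, Xₙ]`, saturated with respect to the irrelevant
ideal `⟨X₀, …, Xₙ⟩`, whose residue class ring has Krull dimension one. -/
structure ZeroDimScheme (K : Type*) [Field K] (n : ℕ) where
  /-- the homogeneous vanishing ideal -/
  ideal : Ideal (MvPolynomial (Fin (n + 1)) K)
  homogeneous : ideal.IsHomogeneous (homogeneousSubmodule (Fin (n + 1)) K)
  saturated : ∀ F : MvPolynomial (Fin (n + 1)) K,
    (∀ i, (X i : MvPolynomial (Fin (n + 1)) K) * F ∈ ideal) → F ∈ ideal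
  dim_zero : ringKrullDim (MvPolynomial (Fin (n + 1)) K ⧸ ideal) = 1

namespace ZeroDimScheme

variable {K : Type*} [Field K] {n : ℕ} (Z : ZeroDimScheme K n)

/-- No point of the scheme lies on the hyperplane `X₀ = 0`: a homogeneous prime ideal which
contains the vanishing ideal and `X₀` contains the whole irrelevant ideal. -/
def AvoidsHyperplane : Prop :=
  ∀ 𝔭 : Ideal (MvPolynomial (Fin (n + 1)) K), 𝔭.IsPrime →
    𝔭.IsHomogeneous (homogeneousSubmodule (Fin (n + 1)) K) → Z.ideal ≤ 𝔭 → X 0 ∈ 𝔭 →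
      ∀ i, X i ∈ 𝔭

/-- The homogeneous coordinate ring `R = P / I`. -/
def CoordRing : Type _ := MvPolynomial (Fin (n + 1)) K ⧸ Z.ideal

instance : CommRing Z.CoordRing := inferInstanceAs (CommRing (_ ⧸ Z.ideal))

instance : Algebra K Z.CoordRing := inferInstanceAs (Algebra K (_ ⧸ Z.ideal))

/-- The residue class map `P → R`. -/
def toCoord : MvPolynomial (Fin (n + 1)) K →ₐ[K] Z.CoordRing := Ideal.Quotient.mkₐ K Z.ideal

/-- The residue class `xᵢ` of `Xᵢ` in `R`. -/
def x (i : Fin (n + 1)) : Z.CoordRing := Z.toCoord (X i)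

/-- The affine coordinate ring `S = R / ⟨x₀ - 1⟩`. For a scheme which avoids the hyperplane
`X₀ = 0` the scheme is `Spec S`; its points are the maximal ideals of `S`. -/
def AffineRing : Type _ := Z.CoordRing ⧸ Ideal.span {Z.x 0 - 1}

instance : CommRing Z.AffineRing :=
  inferInstanceAs (CommRing (Z.CoordRing ⧸ Ideal.span {Z.x 0 - 1}))

instance : Algebra K Z.AffineRing :=
  inferInstanceAs (Algebra K (Z.CoordRing ⧸ Ideal.span {Z.x 0 - 1}))

/-- Dehomogenization `R → S`. -/
def deh : Z.CoordRing →ₐ[K] Z.AffineRing := Ideal.Quotient.mkₐ K (Ideal.span {Z.x 0 - 1})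

/-- The degree `dim_K S`. -/
def degree : ℕ := Module.finrank K Z.AffineRing

/-- The scheme `Spec S` is reduced. -/
def Reduced : Prop := IsReduced Z.AffineRing

/-- The homogeneous component `R_i`, for `i ∈ ℤ`. -/
def component (i : ℤ) : Submodule K Z.CoordRing :=
  if 0 ≤ i then
    (homogeneousSubmodule (Fin (n + 1)) K i.toNat).map Z.toCoord.toLinearMap
  else ⊥

/-- The Hilbert function of the scheme, `i ↦ dim_K R_i`. -/
def hilbertFn (i : ℤ) : ℕ := Module.finrank K (Z.component i)

/-- The Hilbert function of a homogeneous ideal `𝔞` of `R`, `i ↦ dim_K (𝔞 ∩ R_i)`. -/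
def idealHilbertFn (𝔞 : Ideal Z.CoordRing) (i : ℤ) : ℕ :=
  Module.finrank K (𝔞.restrictScalars K ⊓ Z.component i : Submodule K Z.CoordRing)

/-- The regularity index of the Hilbert function of the scheme. -/
def regIndex : ℤ := regularityIndex Z.hilbertFn

/-- The initial degree of the vanishing ideal. -/
def initialDegree : ℕ :=
  sInf {i : ℕ | ∃ F ∈ Z.ideal, F.IsHomogeneous i ∧ F ≠ 0}

/-- Generic position: `HF(i) = min {deg, binom(i + n, n)}` for all `i ∈ ℤ`. The binomial
coefficient is zero for `i < 0` (when `n > 0`). -/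
def GenericPosition : Prop :=
  ∀ i : ℤ, Z.hilbertFn i = min Z.degree ((i + n).toNat.choose n)

/-! ### Kähler different -/

/-- The subring `K[x₀]` of `R`. -/
abbrev baseRing : Subalgebra K Z.CoordRing := Algebra.adjoin K {Z.x 0}

/-- The Kähler different, the initial Fitting ideal of the module of Kähler differentials of
`R` over `K[x₀]`. -/
def kaehlerDifferent : Ideal Z.CoordRing :=
  initialFittingIdeal Z.CoordRing (KaehlerDifferential Z.baseRing Z.CoordRing)

/-! ### Conductor -/

theorem aeval_homogeneous {d : ℕ} {F : MvPolynomial (Fin (n + 1)) K} (hF : F.IsHomogeneous d) :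
    aeval (fun j => Polynomial.C (Z.deh (Z.x j)) * Polynomial.X) F =
      Polynomial.C (Z.deh (Z.toCoord F)) * Polynomial.X ^ d := by
  have hx : ∀ G : MvPolynomial (Fin (n + 1)) K,
      Z.deh (Z.toCoord G) = aeval (fun j => Z.deh (Z.x j)) G := by
    intro G
    have h : (Z.deh.comp Z.toCoord) = aeval (fun j => Z.deh (Z.x j)) := by
      apply MvPolynomial.algHom_ext
      intro i
      simp [x]
    exact DFunLike.congr_fun h G
  rw [hx, aeval_def, aeval_def, eval₂_eq', eval₂_eq', map_sum, Finset.sum_mul]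
  refine Finset.sum_congr rfl fun m hm => ?_
  have hd : ∑ i, m i = d := by
    have h := hF (mem_support_iff.mp hm)
    rw [Finsupp.weight_apply, Finsupp.sum_fintype _ _ (by simp)] at h
    simpa using h
  rw [map_mul, map_prod]
  simp only [mul_pow, Finset.prod_mul_distrib, Finset.prod_pow_eq_pow_sum, hd, map_pow]
  rw [mul_assoc]
  rfl

/-- The embedding `R → S[x₀]` with `f ↦ f^deh x₀^i` for `f ∈ R_i`. Its target is the subring
`R̃ = S[x₀]` of the homogeneous ring of quotients `S[x₀, x₀⁻¹]` of `R`. -/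
def toTilde : Z.CoordRing →ₐ[K] Polynomial Z.AffineRing :=
  Ideal.Quotient.liftₐ Z.ideal
    (aeval (fun j => Polynomial.C (Z.deh (Z.x j)) * Polynomial.X)) (by
      intro F hF
      rw [← sum_homogeneousComponent F, map_sum]
      refine Finset.sum_eq_zero fun d _ => ?_
      have h : homogeneousComponent d F ∈ Z.ideal := by
        rw [← MvPolynomial.decomposition.decompose'_apply]
        exact Z.homogeneous d hF
      rw [Z.aeval_homogeneous (homogeneousComponent_isHomogeneous d F),
        show Z.toCoord (homogeneousComponent d F) = 0 from Ideal.Quotient.eq_zero_iff_mem.mpr h]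
      simp)

/-- The conductor of `R` in `R̃ = S[x₀]`, as an ideal of `R`: all `f` with `f · R̃ ⊆ R`.
(Since `1 ∈ R̃`, an element `f` of the ring of quotients with `f · R̃ ⊆ R` is in `R`.) -/
def conductor : Ideal Z.CoordRing where
  carrier := {f | ∀ g : Polynomial Z.AffineRing, Z.toTilde f * g ∈ Set.range Z.toTilde}
  zero_mem' := fun g => ⟨0, by simp⟩
  add_mem' := by
    intro a b ha hb g
    obtain ⟨u, hu⟩ := ha g
    obtain ⟨v, hv⟩ := hb g
    exact ⟨u + v, by rw [map_add, map_add, add_mul, hu, hv]⟩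
  smul_mem' := by
    intro c a ha g
    obtain ⟨u, hu⟩ := ha g
    exact ⟨c * u, by rw [smul_eq_mul, map_mul, map_mul, hu, mul_assoc]⟩

/-! ### Separators and the Cayley-Bacharach property

Closed subschemes of the scheme `Spec S` are given by ideals `J` of `S`. The decomposition
`S ≅ ∏ⱼ 𝒪ⱼ` into the local rings identifies the tuples `(0, …, 0, a, 0, …, 0)` with the elements
of `S` which vanish in all other local rings. -/

/-- The closed subscheme `Y` defined by `J` is a `p`-subscheme: `𝒪_{Y,p} ≠ 𝒪_{X,p}` and
`𝒪_{Y,q} = 𝒪_{X,q}` for all points `q ≠ p`. -/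
def IsPSubscheme (p : MaximalSpectrum Z.AffineRing) (J : Ideal Z.AffineRing) : Prop :=
  J.map (algebraMap Z.AffineRing (Localization.AtPrime p.asIdeal)) ≠ ⊥ ∧
    ∀ q : MaximalSpectrum Z.AffineRing, q ≠ p →
      J.map (algebraMap Z.AffineRing (Localization.AtPrime q.asIdeal)) = ⊥

/-- A maximal `p`-subscheme: a `p`-subscheme of degree `deg - dim_K K(p)`. -/
def IsMaximalPSubscheme (p : MaximalSpectrum Z.AffineRing) (J : Ideal Z.AffineRing) : Prop :=
  Z.IsPSubscheme p J ∧
    Module.finrank K (Z.AffineRing ⧸ J) + Module.finrank K (Z.AffineRing ⧸ p.asIdeal) = Z.degree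

/-- The least `i ∈ ℕ` such that `a x₀^i` is in the image of `R` in `S[x₀]`. -/
def sepDegree (a : Z.AffineRing) : ℕ :=
  sInf {i : ℕ | Polynomial.C a * Polynomial.X ^ i ∈ Set.range Z.toTilde}

/-- `d` is the maximal degree of a minimal separator of the maximal `p`-subscheme defined by `J`:
here `s ∈ S` generates `J` (so that it is `(0, …, 0, sₚ, 0, …, 0)` with a socle element `sₚ` of the
local ring at `p`), the residue classes of `e₁, …, e_κ` form a `K`-basis of the residue field
`K(p) = S / p`, and `e_k s = (0, …, 0, e_k sₚ, 0, …, 0)` is the dehomogenization of the `k`-th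
minimal separator. -/
def IsMaxSepDegree (p : MaximalSpectrum Z.AffineRing) (J : Ideal Z.AffineRing) (d : ℕ) : Prop :=
  ∃ (s : Z.AffineRing) (κ : ℕ) (e : Fin κ → Z.AffineRing)
    (b : Module.Basis (Fin κ) K (Z.AffineRing ⧸ p.asIdeal)),
    J = Ideal.span {s} ∧ (∀ k, b k = Ideal.Quotient.mk p.asIdeal (e k)) ∧
      d = Finset.univ.sup (fun k => Z.sepDegree (e k * s))

/-- The degree of the point `p` in the scheme: the minimum, over all maximal `p`-subschemes, of the
maximal degree of a minimal separator. -/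
def pointDegree (p : MaximalSpectrum Z.AffineRing) : ℕ :=
  sInf {d : ℕ | ∃ J : Ideal Z.AffineRing, Z.IsMaximalPSubscheme p J ∧ Z.IsMaxSepDegree p J d}

/-- Cayley-Bacharach scheme: every point has the regularity index as its degree. -/
def IsCayleyBacharach : Prop :=
  ∀ p : MaximalSpectrum Z.AffineRing, (Z.pointDegree p : ℤ) = Z.regIndex

end ZeroDimScheme

end

end

noncomputable section

/-! Write `r` for the regularity index and `V_i` (`formImage i`) for the image in `S` of the forms
of degree `i`. Since `x₀` is a nonzerodivisor, `R_i ≅ V_i`; the `V_i` increase strictly until they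
reach `S`, which happens exactly in degree `r` (`regIndex_eq`). Everything is compared with one
condition (*), `NoFormsUpToSurjDegree`: the vanishing ideal `I` has no nonzero form of degree at
most `r`. By counting dimensions, (a) is (*) (`genericPosition_and_iff`).

Under (*) the Kähler different is `R_{≥ nr}`. It is contained there because the partial derivatives
of elements of `I` land in `𝔞 = R_{≥ r}`, so that `Ω` maps onto `(R/𝔞)^n` and the Fitting ideal lies
in `𝔞^n`. For the other inclusion, `kaehlerImage_eq_top` shows that Jacobian determinants of forms
of degree `r + 1` in `I` already fill degree `nr`; this part needs only that `S` is unramified over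
`K`, and uses the separability idempotent of `S ⊗ S`. The hypothesis on the characteristic enters
through unramifiedness and through Euler's formula.

If (*) fails, take a form `F ∈ I` of least degree `α ≤ r`. By Euler's formula some `∂F/∂X_k` with `k
≥ 1` is not in `I`. Jacobian determinants using `F` and `n - 1` forms of degree `r + 1` then give a
nonzero element of the different in degree `α - 1 + (n - 1)r < nr`, contradicting (b)
(`exists_kaehlerImage_ne_bot`).

For (c), a Cayley-Bacharach scheme has conductor `R_{≥ r}`, whose `n`-th power is `R_{≥ nr}`.
Conversely (*) forces the Cayley-Bacharach property: a point of degree below `r` would produce a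
nonzero ideal of `S` inside some `V_d` with `d < r`, and such an ideal can be pushed down degree by
degree until it vanishes. -/

theorem MvPolynomial.IsHomogeneous.aeval_mul_const {R A σ : Type*} [CommSemiring R]
    [CommSemiring A] [Algebra R A] [Fintype σ] {d : ℕ} {F : MvPolynomial σ R}
    (hF : F.IsHomogeneous d) (a : σ → A) (c : A) :
    MvPolynomial.aeval (fun j => a j * c) F = MvPolynomial.aeval a F * c ^ d := by
  rw [aeval_def, aeval_def, eval₂_eq', eval₂_eq', Finset.sum_mul]
  refine Finset.sum_congr rfl fun m hm => ?_
  have hd : ∑ i, m i = d := by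
    have h := hF (mem_support_iff.mp hm)
    rw [Finsupp.weight_apply, Finsupp.sum_fintype _ _ (by simp)] at h
    simpa using h
  simp only [mul_pow, Finset.prod_mul_distrib, Finset.prod_pow_eq_pow_sum, hd]
  rw [mul_assoc]

/-! ### Dehomogenization and the images of forms in `S` -/

namespace ZeroDimScheme

attribute [local instance] MvPolynomial.gradedAlgebra

variable {K : Type*} [Field K] {n : ℕ} (Z : ZeroDimScheme K n)

/-- The residue class map `P → S`. -/
def ev : MvPolynomial (Fin (n + 1)) K →ₐ[K] Z.AffineRing := Z.deh.comp Z.toCoord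

theorem ev_apply (F : MvPolynomial (Fin (n + 1)) K) : Z.ev F = Z.deh (Z.toCoord F) := rfl

theorem toCoord_surjective : Function.Surjective Z.toCoord := Ideal.Quotient.mk_surjective

theorem deh_surjective : Function.Surjective Z.deh := Ideal.Quotient.mk_surjective

theorem ev_surjective : Function.Surjective Z.ev := Z.deh_surjective.comp Z.toCoord_surjective

theorem toCoord_eq_zero_iff {F : MvPolynomial (Fin (n + 1)) K} :
    Z.toCoord F = 0 ↔ F ∈ Z.ideal := Ideal.Quotient.eq_zero_iff_mem

theorem deh_eq_zero_iff {f : Z.CoordRing} :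
    Z.deh f = 0 ↔ f ∈ Ideal.span {Z.x 0 - 1} := Ideal.Quotient.eq_zero_iff_mem

theorem ev_eq_zero_of_mem {F : MvPolynomial (Fin (n + 1)) K} (hF : F ∈ Z.ideal) : Z.ev F = 0 := by
  rw [ev_apply, Z.toCoord_eq_zero_iff.mpr hF, map_zero]

theorem ev_X_zero : Z.ev (X 0) = 1 := by
  have h : Z.deh (Z.x 0 - 1) = 0 := Z.deh_eq_zero_iff.mpr (Ideal.mem_span_singleton_self _)
  rw [map_sub, map_one, sub_eq_zero] at h
  exact h

theorem homogeneousComponent_mem {F : MvPolynomial (Fin (n + 1)) K} (hF : F ∈ Z.ideal) (d : ℕ) :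
    homogeneousComponent d F ∈ Z.ideal :=
  MvPolynomial.homogeneousComponent_mem_of_mem Z.homogeneous hF d

theorem toTilde_toCoord_eq_aeval (F : MvPolynomial (Fin (n + 1)) K) :
    Z.toTilde (Z.toCoord F) =
      aeval (fun j => Polynomial.C (Z.deh (Z.x j)) * Polynomial.X) F := rfl

theorem toTilde_homogeneous {d : ℕ} {F : MvPolynomial (Fin (n + 1)) K} (hF : F.IsHomogeneous d) :
    Z.toTilde (Z.toCoord F) = Polynomial.C (Z.ev F) * Polynomial.X ^ d :=
  (Z.toTilde_toCoord_eq_aeval F).trans (Z.aeval_homogeneous hF)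

theorem coeff_toTilde (F : MvPolynomial (Fin (n + 1)) K) (i : ℕ) :
    (Z.toTilde (Z.toCoord F)).coeff i = Z.ev (homogeneousComponent i F) := by
  conv_lhs => rw [← sum_homogeneousComponent F]
  rw [map_sum, map_sum, Polynomial.finsetSum_coeff]
  simp only [Z.toTilde_homogeneous (homogeneousComponent_isHomogeneous _ F),
    Polynomial.coeff_C_mul_X_pow]
  rw [Finset.sum_ite_eq]
  split_ifs with h
  · rfl
  · rw [homogeneousComponent_eq_zero, map_zero]
    simpa using h

/-- The image in `S` of the forms of degree `i`. -/
def formImage (i : ℕ) : Submodule K Z.AffineRing :=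
  (homogeneousSubmodule (Fin (n + 1)) K i).map Z.ev.toLinearMap

theorem mem_formImage {i : ℕ} {s : Z.AffineRing} :
    s ∈ Z.formImage i ↔ ∃ F : MvPolynomial (Fin (n + 1)) K, F.IsHomogeneous i ∧ Z.ev F = s :=
  Iff.rfl

theorem mem_range_toTilde {g : Polynomial Z.AffineRing} :
    g ∈ Set.range Z.toTilde ↔ ∀ i, g.coeff i ∈ Z.formImage i := by
  constructor
  · rintro ⟨f, rfl⟩ i
    obtain ⟨F, rfl⟩ := Z.toCoord_surjective f
    exact ⟨_, homogeneousComponent_isHomogeneous i F, (Z.coeff_toTilde F i).symm⟩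
  · intro h
    choose F hF hFe using fun i => Z.mem_formImage.mp (h i)
    refine ⟨∑ i ∈ g.support, Z.toCoord (F i), ?_⟩
    conv_rhs => rw [g.as_sum_support_C_mul_X_pow]
    rw [map_sum]
    exact Finset.sum_congr rfl fun i _ => by rw [Z.toTilde_homogeneous (hF i), hFe]

theorem C_mul_X_pow_mem_range {a : Z.AffineRing} {i : ℕ} :
    Polynomial.C a * Polynomial.X ^ i ∈ Set.range Z.toTilde ↔ a ∈ Z.formImage i := by
  rw [mem_range_toTilde]
  constructor
  · intro h
    simpa using h i
  · intro h j
    rw [Polynomial.coeff_C_mul_X_pow]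
    split_ifs with hj
    · exact hj ▸ h
    · exact zero_mem _

theorem formImage_mono : Monotone Z.formImage := by
  refine monotone_nat_of_le_succ fun i s hs => ?_
  obtain ⟨F, hF, rfl⟩ := hs
  refine Z.mem_formImage.mpr ⟨F * X 0, IsHomogeneous.mul hF (isHomogeneous_X K 0), ?_⟩
  rw [map_mul, ev_X_zero, mul_one]
  rfl

/-! ### The irrelevant ideal and the nonzerodivisor `x₀` -/

/-- The irrelevant ideal `⟨X₀, …, Xₙ⟩`. -/
abbrev irrelevant (K : Type*) [Field K] (n : ℕ) : Ideal (MvPolynomial (Fin (n + 1)) K) :=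
  Ideal.span (Set.range X)

variable {Z}

/-- The radical of a homogeneous ideal is the intersection of the homogeneous primes above it, and
avoiding the hyperplane says that these all contain the irrelevant ideal. -/
theorem exists_irrelevant_pow_le (hZ : Z.AvoidsHyperplane) :
    ∃ k, irrelevant K n ^ k ≤ Z.ideal ⊔ Ideal.span {X 0} := by
  refine Ideal.exists_pow_le_of_le_radical_of_fg ?_ (Submodule.fg_span (Set.finite_range _))
  have hh : (Z.ideal ⊔ Ideal.span {X 0}).IsHomogeneous
      (homogeneousSubmodule (Fin (n + 1)) K) := by
    refine Z.homogeneous.sup (Ideal.homogeneous_span _ _ ?_)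
    rintro _ rfl
    exact ⟨1, isHomogeneous_X K 0⟩
  rw [hh.radical_eq, le_sInf_iff]
  rintro 𝔭 ⟨h𝔭h, hle, h𝔭⟩
  rw [Ideal.span_le]
  rintro _ ⟨i, rfl⟩
  exact hZ 𝔭 h𝔭 h𝔭h (le_sup_left.trans hle)
    (hle (Ideal.mem_sup_right (Ideal.mem_span_singleton_self _))) i

theorem mem_of_irrelevant_pow_mul_mem (k : ℕ) :
    ∀ F : MvPolynomial (Fin (n + 1)) K,
      (∀ G ∈ irrelevant K n ^ k, G * F ∈ Z.ideal) → F ∈ Z.ideal := by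
  induction k with
  | zero => intro F h; simpa using h 1 (by simp)
  | succ k ih =>
    intro F h
    refine ih F fun G hG => Z.saturated _ fun i => ?_
    rw [← mul_assoc]
    refine h _ ?_
    rw [pow_succ']
    exact Ideal.mul_mem_mul (Ideal.subset_span ⟨i, rfl⟩) hG

/-- A power of the irrelevant ideal lies in `I + ⟨X₀⟩`, so it multiplies `F` into `I`; saturation
then gives `F ∈ I`. -/
theorem mem_of_X_zero_mul_mem (hZ : Z.AvoidsHyperplane) {F : MvPolynomial (Fin (n + 1)) K}
    (hF : X 0 * F ∈ Z.ideal) : F ∈ Z.ideal := by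
  obtain ⟨k, hk⟩ := exists_irrelevant_pow_le hZ
  refine mem_of_irrelevant_pow_mul_mem k F fun G hG => ?_
  obtain ⟨a, ha, b, hb, rfl⟩ := Submodule.mem_sup.mp (hk hG)
  obtain ⟨c, rfl⟩ := Ideal.mem_span_singleton'.mp hb
  rw [add_mul, mul_assoc]
  exact add_mem (Ideal.mul_mem_right _ _ ha) (Ideal.mul_mem_left _ _ hF)

theorem x_zero_mem_nonZeroDivisors (hZ : Z.AvoidsHyperplane) :
    Z.x 0 ∈ nonZeroDivisors Z.CoordRing := by
  rw [mem_nonZeroDivisors_iff_right]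
  intro f hf
  obtain ⟨F, rfl⟩ := Z.toCoord_surjective f
  rw [x, ← map_mul, toCoord_eq_zero_iff, mul_comm] at hf
  exact Z.toCoord_eq_zero_iff.mpr (mem_of_X_zero_mul_mem hZ hf)

/-- The map `θ : X_j ↦ x_j / x₀` into `R[x₀⁻¹]` kills both `I` and `X₀ - 1`, while it sends a form
`F` of degree `d` to `F / x₀^d`. As `x₀` is a nonzerodivisor, a form vanishing in `S` lies in `I`.
-/
theorem mem_ideal_of_ev_eq_zero (hZ : Z.AvoidsHyperplane) {d : ℕ}
    {F : MvPolynomial (Fin (n + 1)) K} (hF : F.IsHomogeneous d) (h : Z.ev F = 0) :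
    F ∈ Z.ideal := by
  let Q := Localization.Away (Z.x 0)
  let c : Q := IsLocalization.Away.invSelf (Z.x 0)
  have hc : algebraMap Z.CoordRing Q (Z.x 0) * c = 1 := IsLocalization.Away.mul_invSelf _
  have hcu : IsUnit c := IsUnit.of_mul_eq_one_right _ hc
  let θ : MvPolynomial (Fin (n + 1)) K →ₐ[K] Q :=
    aeval (fun j => algebraMap Z.CoordRing Q (Z.x j) * c)
  have hθ : ∀ {e : ℕ} {G : MvPolynomial (Fin (n + 1)) K}, G.IsHomogeneous e →
      θ G = algebraMap Z.CoordRing Q (Z.toCoord G) * c ^ e := by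
    intro e G hG
    have h1 : (aeval fun j => algebraMap Z.CoordRing Q (Z.x j)) =
        (IsScalarTower.toAlgHom K Z.CoordRing Q).comp Z.toCoord := by
      apply MvPolynomial.algHom_ext
      intro i
      simp only [aeval_X]
      rfl
    change aeval _ G = _
    rw [hG.aeval_mul_const (fun j => algebraMap Z.CoordRing Q (Z.x j)) c, h1]
    rfl
  have hI : ∀ G ∈ Z.ideal, θ G = 0 := by
    intro G hG
    rw [← sum_homogeneousComponent G, map_sum]
    refine Finset.sum_eq_zero fun e _ => ?_
    rw [hθ (homogeneousComponent_isHomogeneous e G),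
      Z.toCoord_eq_zero_iff.mpr (Z.homogeneousComponent_mem hG e), map_zero, zero_mul]
  rw [ev_apply, deh_eq_zero_iff] at h
  obtain ⟨g, hg⟩ := Ideal.mem_span_singleton'.mp h
  obtain ⟨G, rfl⟩ := Z.toCoord_surjective g
  have h2 : F - G * (X 0 - 1) ∈ Z.ideal := by
    rw [← toCoord_eq_zero_iff, map_sub, map_mul, map_sub, map_one, ← hg]
    exact sub_self _
  have h3 := hI _ h2
  have h4 : θ (X 0) = 1 := by simp [θ, hc]
  rw [map_sub, map_mul, map_sub, map_one, h4, sub_self, mul_zero, sub_zero, hθ hF] at h3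
  have h5 : algebraMap Z.CoordRing Q (Z.toCoord F) = 0 := (hcu.pow d).mul_left_eq_zero.mp h3
  have hinj : Function.Injective (algebraMap Z.CoordRing Q) :=
    IsLocalization.injective Q (Submonoid.powers_le.mpr (x_zero_mem_nonZeroDivisors hZ))
  rw [← toCoord_eq_zero_iff]
  exact hinj (by rw [h5, map_zero])

theorem toTilde_injective (hZ : Z.AvoidsHyperplane) : Function.Injective Z.toTilde := by
  rw [injective_iff_map_eq_zero]
  intro f hf
  obtain ⟨F, rfl⟩ := Z.toCoord_surjective f
  rw [toCoord_eq_zero_iff, ← sum_homogeneousComponent F]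
  refine sum_mem fun i _ =>
    mem_ideal_of_ev_eq_zero hZ (homogeneousComponent_isHomogeneous i F) ?_
  rw [← coeff_toTilde, hf, Polynomial.coeff_zero]

theorem ideal_ne_top : Z.ideal ≠ ⊤ := by
  intro h
  have := Z.dim_zero
  have hs : Subsingleton (MvPolynomial (Fin (n + 1)) K ⧸ Z.ideal) :=
    Ideal.Quotient.subsingleton_iff.mpr h
  rw [ringKrullDim_eq_bot_of_subsingleton] at this
  exact absurd this (by decide)

theorem affineRing_nontrivial (hZ : Z.AvoidsHyperplane) : Nontrivial Z.AffineRing := by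
  refine ⟨1, 0, fun h => ideal_ne_top (Z := Z) ?_⟩
  rw [Ideal.eq_top_iff_one]
  exact mem_ideal_of_ev_eq_zero hZ (isHomogeneous_one _ _) (by rw [map_one, h])

theorem exists_forall_formImage_eq (hZ : Z.AvoidsHyperplane) :
    ∃ k, ∀ i, k ≤ i → Z.formImage i = Z.formImage k := by
  obtain ⟨k, hk⟩ := exists_irrelevant_pow_le hZ
  have key : ∀ i, k ≤ i → Z.formImage (i + 1) ≤ Z.formImage i := by
    rintro i hi s ⟨F, hF, rfl⟩
    -- High-degree forms lie in `I + ⟨X₀⟩`, so modulo `I` they are `X₀` times something; its part of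
    -- degree `i` has the same image in `S`.
    have hFm : F ∈ irrelevant K n ^ k := by
      refine Ideal.pow_le_pow_right (by omega : k ≤ i + 1)
        ((Ideal.mem_span_pow_iff_exists_isHomogeneous X F).mpr
          ⟨map C F, IsHomogeneous.map hF C, ?_⟩)
      rw [eval_map, eval₂_eta]
    obtain ⟨a, ha, b, hb, hab⟩ := Submodule.mem_sup.mp (hk hFm)
    obtain ⟨G, rfl⟩ := Ideal.mem_span_singleton'.mp hb
    have h := congrArg (fun g => g.coeff (i + 1)) (Z.toTilde_homogeneous hF)
    refine Z.mem_formImage.mpr ⟨_, homogeneousComponent_isHomogeneous i G, ?_⟩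
    rw [← hab, map_add, Z.toCoord_eq_zero_iff.mpr ha, zero_add, map_mul, map_mul,
      Z.toTilde_homogeneous (isHomogeneous_X K 0), ev_X_zero, map_one, one_mul, pow_one] at h
    simp only [Polynomial.coeff_mul_X, coeff_toTilde] at h
    rw [h, hab]
    simp
  refine ⟨k, fun i hi => le_antisymm ?_ (Z.formImage_mono hi)⟩
  induction i, hi using Nat.le_induction with
  | base => exact le_rfl
  | succ i hi ih => exact (key i hi).trans ih

theorem exists_formImage_eq_top (hZ : Z.AvoidsHyperplane) : ∃ k, Z.formImage k = ⊤ := by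
  obtain ⟨k, hk⟩ := exists_forall_formImage_eq hZ
  refine ⟨k, eq_top_iff.mpr fun s _ => ?_⟩
  obtain ⟨F, rfl⟩ := Z.ev_surjective s
  rw [← sum_homogeneousComponent F, map_sum]
  refine sum_mem fun i _ => ?_
  rw [← hk (max i k) (le_max_right _ _)]
  exact Z.formImage_mono (le_max_left _ _) ⟨_, homogeneousComponent_isHomogeneous i F, rfl⟩

theorem affineRing_finite (hZ : Z.AvoidsHyperplane) : Module.Finite K Z.AffineRing := by
  obtain ⟨k, hk⟩ := exists_formImage_eq_top hZ
  rw [Module.finite_def, ← hk]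
  exact (homogeneousSubmodule_fg K (σ := Fin (n + 1)) k).map _

end ZeroDimScheme

/-! ### Hilbert function, regularity index and generic position -/

theorem MvPolynomial.finrank_homogeneousSubmodule (K : Type*) [Field K] (n d : ℕ) :
    Module.finrank K (homogeneousSubmodule (Fin (n + 1)) K d) = (d + n).choose n := by
  let s : Finset (Fin (n + 1) →₀ ℕ) := Finset.finsuppAntidiag Finset.univ d
  have hs : ∀ m : Fin (n + 1) →₀ ℕ, m ∈ s ↔ m.degree = d := by
    intro m
    simp [s, Finsupp.degree_eq_sum]
  have hspan : homogeneousSubmodule (Fin (n + 1)) K d =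
      Submodule.span K (Set.range fun m : s => (monomial (m : Fin (n + 1) →₀ ℕ) (1 : K))) := by
    apply le_antisymm
    · intro F hF
      rw [F.as_sum]
      refine sum_mem fun m hm => ?_
      have hmd : m ∈ s := (hs m).mpr (by
        rw [Finsupp.degree_eq_weight_one]
        exact hF (mem_support_iff.mp hm))
      rw [← mul_one (coeff m F), ← smul_eq_mul, ← smul_monomial]
      exact Submodule.smul_mem _ _ (Submodule.subset_span ⟨⟨m, hmd⟩, rfl⟩)
    · rw [Submodule.span_le]
      rintro _ ⟨m, rfl⟩
      exact isHomogeneous_monomial 1 ((hs m).mp m.2)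
  rw [hspan, finrank_span_eq_card, Fintype.card_coe, Finset.card_finsuppAntidiag_nat_eq_choose,
    Finset.card_univ, Fintype.card_fin]
  · rw [show n + 1 + d - 1 = d + n by omega, ← Nat.choose_symm_add]
  · exact (basisMonomials (Fin (n + 1)) K).linearIndependent.comp _ Subtype.val_injective

namespace ZeroDimScheme

variable {K : Type*} [Field K] {n : ℕ} (Z : ZeroDimScheme K n)

theorem component_natCast (d : ℕ) :
    Z.component d = (homogeneousSubmodule (Fin (n + 1)) K d).map Z.toCoord.toLinearMap := by
  simp [component]

theorem component_of_neg {i : ℤ} (hi : i < 0) : Z.component i = ⊥ := by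
  simp [component, not_le.mpr hi]

theorem map_component (d : ℕ) : (Z.component d).map Z.deh.toLinearMap = Z.formImage d := by
  rw [component_natCast, ← Submodule.map_comp]
  rfl

theorem toTilde_of_mem_component {d : ℕ} {f : Z.CoordRing} (hf : f ∈ Z.component d) :
    Z.toTilde f = Polynomial.C (Z.deh f) * Polynomial.X ^ d := by
  rw [component_natCast] at hf
  obtain ⟨F, hF, rfl⟩ := hf
  exact Z.toTilde_homogeneous hF

variable {Z}

theorem mem_component_of_toTilde (hZ : Z.AvoidsHyperplane) {d : ℕ} {f : Z.CoordRing}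
    {s : Z.AffineRing} (hf : Z.toTilde f = Polynomial.C s * Polynomial.X ^ d) :
    f ∈ Z.component d ∧ Z.deh f = s := by
  obtain ⟨F, hF, hFs⟩ := Z.mem_formImage.mp (Z.C_mul_X_pow_mem_range.mp ⟨f, hf⟩)
  have h : f = Z.toCoord F :=
    toTilde_injective hZ (by rw [hf, Z.toTilde_homogeneous hF, hFs])
  subst h
  refine ⟨?_, hFs⟩
  rw [component_natCast]
  exact ⟨F, hF, rfl⟩

theorem finrank_map_deh (hZ : Z.AvoidsHyperplane) {d : ℕ} {N : Submodule K Z.CoordRing}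
    (hN : N ≤ Z.component d) :
    Module.finrank K (N.map Z.deh.toLinearMap) = Module.finrank K N := by
  rw [← LinearMap.range_domRestrict, LinearMap.finrank_range_of_inj]
  rw [injective_iff_map_eq_zero]
  rintro ⟨f, hf⟩ h
  have h' : Z.deh f = 0 := h
  ext
  apply toTilde_injective hZ
  simp [Z.toTilde_of_mem_component (hN hf), h']

theorem hilbertFn_natCast (hZ : Z.AvoidsHyperplane) (d : ℕ) :
    Z.hilbertFn d = Module.finrank K (Z.formImage d) := by
  rw [hilbertFn, ← finrank_map_deh hZ le_rfl, map_component]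

theorem hilbertFn_of_neg {i : ℤ} (hi : i < 0) : Z.hilbertFn i = 0 := by
  rw [hilbertFn, Z.component_of_neg hi, finrank_bot]

theorem degree_pos (hZ : Z.AvoidsHyperplane) : 0 < Z.degree := by
  have := affineRing_finite hZ
  have := affineRing_nontrivial hZ
  exact Module.finrank_pos

variable (Z) in
/-- The least degree in which the forms map onto `S`. -/
def surjDegree : ℕ := sInf {k | Z.formImage k = ⊤}

theorem formImage_eq_top_iff (hZ : Z.AvoidsHyperplane) {i : ℕ} :
    Z.formImage i = ⊤ ↔ Z.surjDegree ≤ i := by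
  refine ⟨fun h => Nat.sInf_le h, fun h => ?_⟩
  have h1 : Z.formImage Z.surjDegree = ⊤ := Nat.sInf_mem (exists_formImage_eq_top hZ)
  exact eq_top_iff.mpr (h1 ▸ Z.formImage_mono h)

theorem mem_formImage_of_le (hZ : Z.AvoidsHyperplane) {i : ℕ} (hi : Z.surjDegree ≤ i)
    (s : Z.AffineRing) : s ∈ Z.formImage i := by
  rw [(formImage_eq_top_iff hZ).mpr hi]
  trivial

theorem finrank_formImage_eq_degree_iff (hZ : Z.AvoidsHyperplane) {i : ℕ} :
    Module.finrank K (Z.formImage i) = Z.degree ↔ Z.surjDegree ≤ i := by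
  have := affineRing_finite hZ
  rw [← formImage_eq_top_iff hZ]
  exact ⟨Submodule.eq_top_of_finrank_eq, fun h => by rw [h, finrank_top]; rfl⟩

theorem regIndex_eq (hZ : Z.AvoidsHyperplane) : Z.regIndex = Z.surjDegree := by
  have hset : {i : ℤ | ∃ p : Polynomial ℚ, ∀ j : ℤ, i ≤ j → (Z.hilbertFn j : ℚ) = p.eval (j : ℚ)} =
      Set.Ici (Z.surjDegree : ℤ) := by
    have hlarge : ∀ j : ℤ, (Z.surjDegree : ℤ) ≤ j → Z.hilbertFn j = Z.degree := by
      intro j hj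
      lift j to ℕ using by omega
      rw [hilbertFn_natCast hZ, (finrank_formImage_eq_degree_iff hZ).mpr (by omega)]
    ext i
    constructor
    · rintro ⟨p, hp⟩
      -- The Hilbert polynomial is constant, because the Hilbert function equals the degree in all
      -- large degrees.
      have hpc : p = Polynomial.C (Z.degree : ℚ) := by
        refine Polynomial.eq_of_infinite_eval_eq _ _
          (Set.Infinite.mono (s := (fun j : ℤ => (j : ℚ)) '' Set.Ici (max i Z.surjDegree)) ?_ ?_)
        · rintro _ ⟨j, hj, rfl⟩
          rw [Set.mem_Ici, max_le_iff] at hj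
          rw [Set.mem_ofPred_eq, ← hp j hj.1, hlarge j hj.2, Polynomial.eval_C]
        · exact (Set.Ici_infinite _).image Int.cast_injective.injOn
      have hi : Z.hilbertFn i = Z.degree := by
        have := hp i le_rfl
        rw [hpc, Polynomial.eval_C] at this
        exact_mod_cast this
      have h0 : 0 ≤ i := by
        by_contra h
        rw [hilbertFn_of_neg (not_le.mp h)] at hi
        exact (degree_pos hZ).ne hi
      lift i to ℕ using h0
      rw [hilbertFn_natCast hZ, finrank_formImage_eq_degree_iff hZ] at hi
      exact Set.mem_Ici.mpr (by exact_mod_cast hi)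
    · intro hi
      exact ⟨Polynomial.C (Z.degree : ℚ), fun j hj => by
        rw [hlarge j (le_trans hi hj), Polynomial.eval_C]⟩
  rw [regIndex, regularityIndex, hset, csInf_Ici]

theorem formImage_succ (i : ℕ) :
    Z.formImage (i + 1) = Z.formImage i * Z.formImage 1 := by
  rw [formImage, formImage, formImage, ← Submodule.map_mul, ← homogeneousSubmodule_one_pow (σ := Fin (n + 1)) (R := K) (i + 1),
    pow_succ, homogeneousSubmodule_one_pow]

/-- Since `V_{i+1} = V_i · V_1`, one equality `V_i = V_{i+1}` makes the chain constant from there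
on, before it has reached `S`. -/
theorem formImage_lt_succ (hZ : Z.AvoidsHyperplane) {i : ℕ} (hi : i < Z.surjDegree) :
    Z.formImage i < Z.formImage (i + 1) := by
  refine (Z.formImage_mono (Nat.le_succ i)).lt_of_ne fun h => ?_
  have hst : ∀ j, i ≤ j → Z.formImage j = Z.formImage i := by
    intro j hj
    induction j, hj using Nat.le_induction with
    | base => rfl
    | succ j _ ih => rw [formImage_succ, ih, ← formImage_succ, ← h]
  have := (formImage_eq_top_iff hZ (i := Z.surjDegree)).mpr le_rfl
  rw [hst _ hi.le, formImage_eq_top_iff hZ] at this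
  omega

theorem lt_finrank_formImage (hZ : Z.AvoidsHyperplane) {i : ℕ} (hi : i ≤ Z.surjDegree) :
    i < Module.finrank K (Z.formImage i) := by
  have := affineRing_finite hZ
  have := affineRing_nontrivial hZ
  induction i with
  | zero =>
    have h1 : (1 : Z.AffineRing) ∈ Z.formImage 0 := ⟨1, isHomogeneous_one _ _, map_one Z.ev⟩
    rw [Module.finrank_pos_iff_exists_ne_zero]
    exact ⟨⟨1, h1⟩, fun h => one_ne_zero (congrArg Subtype.val h)⟩
  | succ i ih =>
    have h1 := ih (by omega)
    have h2 := Submodule.finrank_lt_finrank_of_lt (formImage_lt_succ hZ (i := i) (by omega))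
    omega

/-- Needed to make integers between `1` and `r` invertible in `K` when the characteristic is
positive. -/
theorem surjDegree_lt_degree (hZ : Z.AvoidsHyperplane) : Z.surjDegree < Z.degree := by
  rw [← (finrank_formImage_eq_degree_iff hZ).mpr le_rfl]
  exact lt_finrank_formImage hZ le_rfl

variable (Z) in
/-- The vanishing ideal contains no non-zero forms of degree at most `Z.surjDegree`. -/
def NoFormsUpToSurjDegree : Prop :=
  ∀ j ≤ Z.surjDegree, ∀ F ∈ Z.ideal, F.IsHomogeneous j → F = 0

theorem finrank_formImage_eq_choose_iff (hZ : Z.AvoidsHyperplane) (i : ℕ) :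
    Module.finrank K (Z.formImage i) = (i + n).choose n ↔
      ∀ F ∈ Z.ideal, F.IsHomogeneous i → F = 0 := by
  have : Module.Finite K (homogeneousSubmodule (Fin (n + 1)) K i) :=
    Module.Finite.iff_fg.mpr (homogeneousSubmodule_fg K (σ := Fin (n + 1)) i)
  let φ := Z.ev.toLinearMap.domRestrict (homogeneousSubmodule (Fin (n + 1)) K i)
  have hφ : Z.formImage i = LinearMap.range φ := (LinearMap.range_domRestrict _ _).symm
  have hrn := φ.finrank_range_add_finrank_ker
  rw [← hφ, MvPolynomial.finrank_homogeneousSubmodule] at hrn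
  have hk : Module.finrank K (LinearMap.ker φ) = 0 ↔
      ∀ F ∈ Z.ideal, F.IsHomogeneous i → F = 0 := by
    rw [Submodule.finrank_eq_zero, LinearMap.ker_eq_bot']
    constructor
    · intro h F hF hFi
      exact congrArg Subtype.val (h ⟨F, hFi⟩ (Z.ev_eq_zero_of_mem hF))
    · rintro h ⟨F, hFi⟩ hF
      exact Subtype.ext (h F (mem_ideal_of_ev_eq_zero hZ hFi hF) hFi)
  rw [← hk]
  omega

theorem genericPosition_and_iff (hn : 2 ≤ n) (hZ : Z.AvoidsHyperplane) :
    (Z.GenericPosition ∧ Z.degree = (n + Z.initialDegree - 1).choose n) ↔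
      Z.NoFormsUpToSurjDegree := by
  have hdeg := degree_pos hZ
  constructor
  · rintro ⟨hg, hd⟩
    -- For initial degree `0` the binomial coefficient would be `(n - 1).choose n = 0`, but the
    -- degree is positive.
    have hα : 0 < Z.initialDegree := by
      by_contra h
      rw [Nat.eq_zero_of_not_pos h, Nat.choose_eq_zero_of_lt (by omega)] at hd
      omega
    have hr : Z.surjDegree ≤ Z.initialDegree - 1 := by
      rw [← finrank_formImage_eq_degree_iff hZ, ← hilbertFn_natCast hZ, hg]
      rw [show (((Z.initialDegree - 1 : ℕ) : ℤ) + n).toNat = n + Z.initialDegree - 1 by omega,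
        ← hd, min_self]
    intro j hj F hF hFj
    by_contra h0
    have : Z.initialDegree ≤ j := Nat.sInf_le ⟨F, hF, hFj, h0⟩
    omega
  · intro h
    have hlow : ∀ i : ℕ, i ≤ Z.surjDegree →
        Module.finrank K (Z.formImage i) = (i + n).choose n :=
      fun i hi => (finrank_formImage_eq_choose_iff hZ i).mpr (h i hi)
    have hdr : Z.degree = (Z.surjDegree + n).choose n := by
      rw [← hlow _ le_rfl, (finrank_formImage_eq_degree_iff hZ).mpr le_rfl]
    have hinit : Z.initialDegree = Z.surjDegree + 1 := by
      -- In degree `r + 1` the Hilbert function is still `(r + n).choose n`, strictly less than `(r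
      -- + 1 + n).choose n`.
      have hne : ¬ ∀ F ∈ Z.ideal, F.IsHomogeneous (Z.surjDegree + 1) → F = 0 := by
        rw [← finrank_formImage_eq_choose_iff hZ,
          (finrank_formImage_eq_degree_iff hZ).mpr (Nat.le_succ _), hdr]
        have h1 : 0 < (Z.surjDegree + n).choose (n - 1) := Nat.choose_pos (by omega)
        rw [show Z.surjDegree + 1 + n = (Z.surjDegree + n) + 1 by omega,
          Nat.choose_succ_left _ _ (by omega)]
        omega
      push Not at hne
      obtain ⟨F, hF, hFi, hF0⟩ := hne
      refine le_antisymm (Nat.sInf_le ⟨F, hF, hFi, hF0⟩) ?_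
      refine le_csInf ⟨_, F, hF, hFi, hF0⟩ ?_
      rintro j ⟨G, hG, hGj, hG0⟩
      by_contra hj
      exact hG0 (h j (by omega) G hG hGj)
    refine ⟨fun i => ?_, ?_⟩
    · rcases lt_or_ge i 0 with hi | hi
      · rw [hilbertFn_of_neg hi, Nat.choose_eq_zero_of_lt (by omega), Nat.min_zero]
      · lift i to ℕ using hi
        rw [hilbertFn_natCast hZ, show ((i : ℤ) + n).toNat = i + n by omega]
        rcases le_total i Z.surjDegree with hi | hi
        · rw [hlow i hi, hdr, min_eq_right]
          exact Nat.choose_le_choose _ (by omega)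
        · rw [(finrank_formImage_eq_degree_iff hZ).mpr hi, hdr, min_eq_left]
          exact Nat.choose_le_choose _ (by omega)
    · rw [hinit, hdr]
      congr 1
      omega

end ZeroDimScheme

/-! ### Bounding Fitting ideals -/

theorem Matrix.det_mem_ideal_pow {A ι : Type*} [CommRing A] [Fintype ι] [DecidableEq ι]
    {𝔞 : Ideal A} (M : Matrix ι ι A) (T : Finset ι) (h : ∀ i, ∀ j ∈ T, M i j ∈ 𝔞) :
    M.det ∈ 𝔞 ^ T.card := by
  rw [Matrix.det_apply]
  refine sum_mem fun σ _ => ?_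
  rw [Units.smul_def, zsmul_eq_mul]
  refine Ideal.mul_mem_left _ _ ?_
  rw [← Finset.prod_mul_prod_compl T, ← Finset.prod_const]
  exact Ideal.mul_mem_right _ _ (Ideal.prod_mem_prod fun i hi => h _ i hi)

/-- Let `D` lift the images of the generators and let `C` express preimages of the unit vectors, so
that `BD ≡ 0` and `CD ≡ 1` modulo `𝔞`. A unipotent column operation embeds `B` into a larger matrix
with the same determinant whose last `n` columns have entries in `𝔞`. -/
theorem initialFittingIdeal_le_pow {A M : Type*} [CommRing A] [AddCommGroup M] [Module A M]
    {n : ℕ} {𝔞 : Ideal A} (φ : M →ₗ[A] (Fin n → A ⧸ 𝔞)) (hφ : Function.Surjective φ) :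
    initialFittingIdeal A M ≤ 𝔞 ^ n := by
  classical
  rw [initialFittingIdeal, Ideal.span_le]
  rintro _ ⟨k, m, B, hm, hB, rfl⟩
  choose D hD using fun i j => Ideal.Quotient.mk_surjective (φ (m i) j)
  have hlin : ∀ (c : Fin k → A) (l : Fin n),
      Ideal.Quotient.mk 𝔞 (∑ i, c i * D i l) = φ (∑ i, c i • m i) l := by
    intro c l
    simp only [map_sum, map_mul, hD, map_smul, Finset.sum_apply, Algebra.smul_def]
    rfl
  have hC : ∀ l : Fin n, ∃ c : Fin k → A, φ (∑ i, c i • m i) = Pi.single l 1 := by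
    intro l
    obtain ⟨y, hy⟩ := hφ (Pi.single l 1)
    have hyt : y ∈ Submodule.span A (Set.range m) := hm ▸ Submodule.mem_top
    obtain ⟨c, rfl⟩ := (Submodule.mem_span_range_iff_exists_fun A).mp hyt
    exact ⟨c, hy⟩
  choose C hC using hC
  let D' : Matrix (Fin k) (Fin n) A := Matrix.of D
  let C' : Matrix (Fin n) (Fin k) A := Matrix.of C
  have hBD : ∀ i l, (B * D') i l ∈ 𝔞 := by
    intro i l
    rw [← Ideal.Quotient.eq_zero_iff_mem]
    refine (hlin (B i) l).trans ?_
    rw [hB, map_zero, Pi.zero_apply]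
  have hCD : ∀ i l, (-(C' * D') + 1 : Matrix (Fin n) (Fin n) A) i l ∈ 𝔞 := by
    intro i l
    rw [← Ideal.Quotient.eq_zero_iff_mem, Matrix.add_apply, Matrix.neg_apply, map_add, map_neg,
      neg_add_eq_zero]
    refine (hlin (C i) l).trans ?_
    rw [hC, Matrix.one_apply, Pi.single_apply]
    by_cases h : i = l
    · simp [h]
    · simp [h, Ne.symm h]
  have hdet : B.det = (Matrix.fromBlocks B (B * D') (-C') (-(C' * D') + 1)).det := by
    have h1 : Matrix.fromBlocks B (B * D') (-C') (-(C' * D') + 1) =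
        Matrix.fromBlocks B 0 (-C') 1 * Matrix.fromBlocks 1 D' 0 1 := by
      simp [Matrix.fromBlocks_multiply]
    rw [h1, Matrix.det_mul, Matrix.det_fromBlocks_zero₁₂, Matrix.det_fromBlocks_zero₂₁]
    simp
  rw [hdet]
  have hT := Matrix.det_mem_ideal_pow (𝔞 := 𝔞)
    (Matrix.fromBlocks B (B * D') (-C') (-(C' * D') + 1))
    (Finset.univ.map Function.Embedding.inr) (by
      intro i j hj
      obtain ⟨l, -, rfl⟩ := Finset.mem_map.mp hj
      rcases i with i | i
      · exact hBD i l
      · exact hCD i l)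
  simpa using hT

namespace ZeroDimScheme

variable {K : Type*} [Field K] {n : ℕ} (Z : ZeroDimScheme K n)

/-! ### Determinants of Jacobian matrices in the Kähler different -/

theorem kaehlerD_x_zero : KaehlerDifferential.D Z.baseRing Z.CoordRing (Z.x 0) = 0 :=
  (KaehlerDifferential.D Z.baseRing Z.CoordRing).map_algebraMap
    (⟨Z.x 0, Algebra.self_mem_adjoin_singleton K _⟩ : Z.baseRing)

theorem kaehlerD_toCoord (F : MvPolynomial (Fin (n + 1)) K) :
    KaehlerDifferential.D Z.baseRing Z.CoordRing (Z.toCoord F) =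
      ∑ j : Fin n, Z.toCoord (pderiv j.succ F) •
        KaehlerDifferential.D Z.baseRing Z.CoordRing (Z.x j.succ) := by
  have h : KaehlerDifferential.D Z.baseRing Z.CoordRing (Z.toCoord F) =
      ∑ j : Fin (n + 1), Z.toCoord (pderiv j F) •
        KaehlerDifferential.D Z.baseRing Z.CoordRing (Z.x j) := by
    induction F using MvPolynomial.induction_on with
    | C a =>
      have h1 : Z.toCoord (C a) = algebraMap Z.baseRing Z.CoordRing (algebraMap K _ a) :=
        Z.toCoord.commutes a
      rw [h1, Derivation.map_algebraMap]
      simp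
    | add p q hp hq =>
      simp only [map_add, add_smul, Finset.sum_add_distrib, hp, hq]
    | mul_X p i hp =>
      rw [map_mul, Derivation.leibniz, hp, Finset.smul_sum]
      simp only [pderiv_mul, map_add, map_mul, add_smul, Finset.sum_add_distrib]
      refine (add_comm _ _).trans (congrArg₂ _ ?_ ?_)
      · exact Finset.sum_congr rfl fun j _ => by rw [smul_smul, mul_comm]
      · symm
        rw [Finset.sum_eq_single i]
        · simp [x]
        · intro j _ hj
          rw [pderiv_X_of_ne hj.symm, map_zero, mul_zero, zero_smul]
        · simp
  rw [h, Fin.sum_univ_succ, kaehlerD_x_zero, smul_zero, zero_add]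

/-- Because `dx₀ = 0`, the module `Ω` is generated by `dx₁, …, dx_n`, and `dF_i = 0` is a relation
among them. -/
theorem det_jacobian_mem_kaehlerDifferent (F : Fin n → MvPolynomial (Fin (n + 1)) K)
    (hF : ∀ i, F i ∈ Z.ideal) :
    Z.toCoord (Matrix.det (Matrix.of fun i j : Fin n => pderiv j.succ (F i))) ∈
      Z.kaehlerDifferent := by
  refine Ideal.subset_span ⟨n, fun j => KaehlerDifferential.D Z.baseRing Z.CoordRing (Z.x j.succ),
    Matrix.of fun i j : Fin n => Z.toCoord (pderiv j.succ (F i)), ?_, ?_, ?_⟩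
  · rw [eq_top_iff, ← KaehlerDifferential.span_range_derivation, Submodule.span_le]
    rintro _ ⟨f, rfl⟩
    obtain ⟨G, rfl⟩ := Z.toCoord_surjective f
    rw [kaehlerD_toCoord]
    exact sum_mem fun j _ => Submodule.smul_mem _ _ (Submodule.subset_span ⟨j, rfl⟩)
  · intro i
    simp only [Matrix.of_apply]
    rw [← kaehlerD_toCoord, Z.toCoord_eq_zero_iff.mpr (hF i), map_zero]
  · exact AlgHom.map_det Z.toCoord _

/-! ### An upper bound for the Kähler different -/

/-- The derivation `R → R / 𝔞` induced by `∂ / ∂ Xⱼ`, if the `j`-th partial derivatives of the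
elements of the vanishing ideal have their residue classes in `𝔞`. -/
def partialDerivation (𝔞 : Ideal Z.CoordRing) (j : Fin n)
    (h : ∀ F ∈ Z.ideal, Z.toCoord (pderiv j.succ F) ∈ 𝔞) :
    Derivation Z.baseRing Z.CoordRing (Z.CoordRing ⧸ 𝔞) := by
  let δ : Z.CoordRing → Z.CoordRing ⧸ 𝔞 := fun f =>
    Ideal.Quotient.mk 𝔞 (Z.toCoord (pderiv j.succ (Function.surjInv Z.toCoord_surjective f)))
  have hδ : ∀ F, δ (Z.toCoord F) = Ideal.Quotient.mk 𝔞 (Z.toCoord (pderiv j.succ F)) := by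
    intro F
    rw [Ideal.Quotient.eq, ← map_sub, ← map_sub]
    apply h
    rw [← toCoord_eq_zero_iff, map_sub, Function.surjInv_eq Z.toCoord_surjective, sub_self]
  have hmul : ∀ f g, δ (f * g) = f • δ g + g • δ f := by
    intro f g
    obtain ⟨F, rfl⟩ := Z.toCoord_surjective f
    obtain ⟨G, rfl⟩ := Z.toCoord_surjective g
    rw [← map_mul, hδ, hδ, hδ, pderiv_mul, map_add, map_mul, map_mul, map_add, map_mul, map_mul,
      Algebra.smul_def, Algebra.smul_def, add_comm,
      mul_comm (Ideal.Quotient.mk 𝔞 (Z.toCoord (pderiv j.succ F)))]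
    rfl
  have hadd : ∀ f g, δ (f + g) = δ f + δ g := by
    intro f g
    obtain ⟨F, rfl⟩ := Z.toCoord_surjective f
    obtain ⟨G, rfl⟩ := Z.toCoord_surjective g
    rw [← map_add, hδ, hδ, hδ, map_add, map_add, map_add]
  have hbase : ∀ c ∈ Z.baseRing, δ c = 0 := by
    intro c hc
    induction hc using Algebra.adjoin_induction with
    | mem c hc =>
      rw [Set.mem_singleton_iff.mp hc, x, hδ, pderiv_X_of_ne (Fin.succ_ne_zero j).symm, map_zero,
        map_zero]
    | algebraMap a =>
      rw [← Z.toCoord.commutes a, hδ, algebraMap_eq, pderiv_C, map_zero, map_zero]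
    | add c d _ _ hc hd => rw [hadd, hc, hd, add_zero]
    | mul c d _ _ hc hd => rw [hmul, hc, hd, smul_zero, smul_zero, add_zero]
  exact
    { toFun := δ
      map_add' := hadd
      map_smul' := fun c f => by
        rw [Algebra.smul_def, hmul]
        have h0 : δ (algebraMap Z.baseRing Z.CoordRing c) = 0 := hbase _ c.2
        rw [h0, smul_zero, add_zero]
        rfl
      map_one_eq_zero' := hbase 1 (one_mem _)
      leibniz' := hmul }

theorem partialDerivation_toCoord (𝔞 : Ideal Z.CoordRing) (j : Fin n)
    (h : ∀ F ∈ Z.ideal, Z.toCoord (pderiv j.succ F) ∈ 𝔞) (F : MvPolynomial (Fin (n + 1)) K) :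
    Z.partialDerivation 𝔞 j h (Z.toCoord F) =
      Ideal.Quotient.mk 𝔞 (Z.toCoord (pderiv j.succ F)) := by
  change Ideal.Quotient.mk 𝔞 _ = _
  rw [Ideal.Quotient.eq, ← map_sub, ← map_sub]
  apply h
  rw [← toCoord_eq_zero_iff, map_sub, Function.surjInv_eq Z.toCoord_surjective, sub_self]

/-- The derivations `∂/∂X_j : R → R/𝔞` assemble to a map `Ω → (R/𝔞)^n`, surjective since the `dx_j`
go to the unit vectors. -/
theorem kaehlerDifferent_le_pow {𝔞 : Ideal Z.CoordRing}
    (h : ∀ F ∈ Z.ideal, ∀ j : Fin n, Z.toCoord (pderiv j.succ F) ∈ 𝔞) :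
    Z.kaehlerDifferent ≤ 𝔞 ^ n := by
  classical
  let φ : KaehlerDifferential Z.baseRing Z.CoordRing →ₗ[Z.CoordRing] (Fin n → Z.CoordRing ⧸ 𝔞) :=
    LinearMap.pi fun j => (Z.partialDerivation 𝔞 j fun F hF => h F hF j).liftKaehlerDifferential
  have hφ : ∀ (i l : Fin n), φ (KaehlerDifferential.D Z.baseRing Z.CoordRing (Z.x i.succ)) l =
      Ideal.Quotient.mk 𝔞 (Z.toCoord (pderiv l.succ (X i.succ))) := fun i l =>
    (Derivation.liftKaehlerDifferential_comp_D _ _).trans (Z.partialDerivation_toCoord _ _ _ _)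
  refine initialFittingIdeal_le_pow φ fun v => ?_
  choose a ha using fun j => Ideal.Quotient.mk_surjective (v j)
  refine ⟨∑ j : Fin n, a j • KaehlerDifferential.D Z.baseRing Z.CoordRing (Z.x j.succ), ?_⟩
  ext l
  rw [map_sum, Finset.sum_apply, Finset.sum_eq_single l]
  · rw [map_smul, Pi.smul_apply, hφ, pderiv_X_self, map_one, map_one, Algebra.smul_def, mul_one]
    exact ha l
  · intro j _ hj
    rw [map_smul, Pi.smul_apply, hφ, pderiv_X_of_ne (fun h => hj (Fin.succ_injective _ h)),
      map_zero, map_zero, smul_zero]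
  · simp

/-- The ideal `⨁_{j ≥ i} Rⱼ` of `R`. -/
def tailIdeal (i : ℕ) : Ideal Z.CoordRing :=
  (Ideal.span {(Polynomial.X : Polynomial Z.AffineRing) ^ i}).comap Z.toTilde

theorem mem_tailIdeal {i : ℕ} {f : Z.CoordRing} :
    f ∈ Z.tailIdeal i ↔ Polynomial.X ^ i ∣ Z.toTilde f := Ideal.mem_span_singleton

theorem toCoord_mem_tailIdeal {i d : ℕ} (hd : i ≤ d) {F : MvPolynomial (Fin (n + 1)) K}
    (hF : F.IsHomogeneous d) : Z.toCoord F ∈ Z.tailIdeal i := by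
  rw [mem_tailIdeal, Z.toTilde_homogeneous hF]
  exact Dvd.dvd.mul_left (pow_dvd_pow _ hd) _

theorem tailIdeal_pow_le (i m : ℕ) : Z.tailIdeal i ^ m ≤ Z.tailIdeal (m * i) := by
  refine Ideal.le_comap_pow _ _ |>.trans ?_
  rw [tailIdeal, Ideal.span_singleton_pow, ← pow_mul, mul_comm]

/-- Nonzero forms in `I` have degree at least `r + 1`, so their partial derivatives lie in `R_{≥
r}`. -/
theorem kaehlerDifferent_le_tailIdeal (h : Z.NoFormsUpToSurjDegree) :
    Z.kaehlerDifferent ≤ Z.tailIdeal (n * Z.surjDegree) := by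
  refine (Z.kaehlerDifferent_le_pow fun F hF j => ?_).trans (Z.tailIdeal_pow_le _ _)
  rw [← sum_homogeneousComponent F, map_sum, map_sum]
  refine sum_mem fun d _ => ?_
  rcases le_or_gt d Z.surjDegree with hd | hd
  · rw [h d hd _ (Z.homogeneousComponent_mem hF d) (homogeneousComponent_isHomogeneous d F),
      map_zero, map_zero]
    exact zero_mem _
  · exact Z.toCoord_mem_tailIdeal (by omega : Z.surjDegree ≤ d - 1)
      (homogeneousComponent_isHomogeneous d F).pderiv

end ZeroDimScheme

/-! ### Determinants -/

theorem MultilinearMap.map_mem_of_mem_span {R M N ι : Type*} [CommSemiring R] [AddCommMonoid M]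
    [AddCommMonoid N] [Module R M] [Module R N] [Fintype ι] [DecidableEq ι]
    (f : MultilinearMap R (fun _ : ι => M) N) (G : ι → Set M) (Q : Submodule R N)
    (h : ∀ w : ι → M, (∀ i, w i ∈ G i) → f w ∈ Q) (v : ι → M)
    (hv : ∀ i, v i ∈ Submodule.span R (G i)) : f v ∈ Q := by
  choose m c g hg using fun i => Submodule.mem_span_set'.mp (hv i)
  rw [show v = fun i => ∑ j, c i j • (g i j : M) from funext fun i => (hg i).symm,
    MultilinearMap.map_sum]
  refine sum_mem fun r _ => ?_
  rw [MultilinearMap.map_smul_univ]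
  exact Q.smul_mem _ (h _ fun i => (g i (r i)).2)

/-- The scalars `R` may be smaller than `A`: below, `A = S ⊗ S` is viewed over its left factor `S`.
-/
theorem Matrix.det_mem_of_mem_span {R A ι : Type*} [CommRing R] [CommRing A] [Algebra R A]
    [Fintype ι] [DecidableEq ι] (G : ι → Set (ι → A)) (Q : Submodule R A)
    (h : ∀ w : ι → ι → A, (∀ i, w i ∈ G i) → (Matrix.of w).det ∈ Q) (v : ι → ι → A)
    (hv : ∀ i, v i ∈ Submodule.span R (G i)) : (Matrix.of v).det ∈ Q :=
  MultilinearMap.map_mem_of_mem_span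
    ((Matrix.detRowAlternating (R := A) (n := ι)).toMultilinearMap.restrictScalars R) G Q h v hv

/-- Multiplied by `e` the matrix becomes `e` times the identity; multiplied by `1 - e` it has rank
one, and its determinant vanishes because the size is at least two. -/
theorem Matrix.det_idempotent_add_vecMulVec {A ι : Type*} [CommRing A] [Fintype ι] [DecidableEq ι]
    [Nontrivial ι] {e : A} (he : e * e = e) (y z : ι → A) (hy : ∀ i, y i * e = 0) :
    (Matrix.of fun i j => (if i = j then e else 0) + y i * z j).det = e := by
  set M : Matrix ι ι A := Matrix.of fun i j => (if i = j then e else 0) + y i * z j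
  have hi : IsIdempotentElem e := he
  have hcard : Fintype.card ι ≠ 0 := Fintype.card_ne_zero
  have h1 : e * M.det = e := by
    have h : e • M = e • (1 : Matrix ι ι A) := by
      ext i j
      simp only [M, Matrix.smul_apply, Matrix.of_apply, Matrix.one_apply, smul_eq_mul]
      split_ifs
      · linear_combination he + z j * hy i
      · linear_combination z j * hy i
    have h' := congrArg Matrix.det h
    rwa [Matrix.det_smul, Matrix.det_smul, Matrix.det_one, mul_one, hi.pow_eq hcard] at h'
  have h2 : (1 - e) * M.det = 0 := by
    have h : (1 - e) • M = Matrix.vecMulVec y z := by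
      ext i j
      simp only [M, Matrix.smul_apply, Matrix.of_apply, Matrix.vecMulVec_apply, smul_eq_mul]
      split_ifs
      · linear_combination -he - z j * hy i
      · linear_combination - z j * hy i
    have h' := congrArg Matrix.det h
    rwa [Matrix.det_smul, Matrix.det_vecMulVec, hi.one_sub.pow_eq hcard] at h'
  linear_combination h1 + h2

theorem Matrix.det_updateRow_one {A ι : Type*} [CommRing A] [Fintype ι] [DecidableEq ι] (k : ι)
    (v : ι → A) : ((1 : Matrix ι ι A).updateRow k v).det = v k := by
  rw [← Matrix.cramer_transpose_apply, Matrix.transpose_one, Matrix.cramer_one]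
  rfl

theorem MvPolynomial.IsHomogeneous.det {R σ ι : Type*} [CommRing R] [Fintype ι] [DecidableEq ι]
    {M : Matrix ι ι (MvPolynomial σ R)} {d : ι → ℕ} (h : ∀ i j, (M i j).IsHomogeneous (d i)) :
    M.det.IsHomogeneous (∑ i, d i) := by
  rw [Matrix.det_apply]
  refine IsHomogeneous.sum _ _ _ fun τ _ => ?_
  have hp := IsHomogeneous.prod Finset.univ (fun i => M (τ i) i) (fun i => d (τ i))
    fun i _ => h _ _
  rw [Equiv.sum_comp τ d] at hp
  rcases Int.units_eq_one_or (Equiv.Perm.sign τ) with hs | hs <;> rw [hs]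
  · simpa using hp
  · simpa using hp.neg

/-! ### Reduced algebras of small dimension are unramified -/

/-- In characteristic `p`, an inseparable minimal polynomial has the form `g(X^p)`, hence degree at
least `p > [L : K]`. -/
theorem Algebra.isSeparable_of_finrank_lt_ringChar (K L : Type*) [Field K] [Field L] [Algebra K L]
    [FiniteDimensional K L] (h : ringChar K = 0 ∨ Module.finrank K L < ringChar K) :
    Algebra.IsSeparable K L := by
  rcases h with h | h
  · have : CharZero K := (CharP.ringChar_zero_iff_CharZero K).mp h
    infer_instance
  · have hp : ringChar K ≠ 0 := by omega
    have : Fact (ringChar K).Prime := ⟨(CharP.char_is_prime_or_zero K _).resolve_right hp⟩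
    refine ⟨fun x => ?_⟩
    rcases Polynomial.separable_or (ringChar K)
      (minpoly.irreducible (Algebra.IsIntegral.isIntegral (R := K) x)) with hs | ⟨-, g, hg, hgx⟩
    · exact hs
    · have h1 := minpoly.natDegree_le (A := K) x
      rw [← hgx, Polynomial.natDegree_expand] at h1
      have h2 : 0 < g.natDegree := hg.natDegree_pos
      have h3 := Nat.le_mul_of_pos_left (ringChar K) h2
      omega

theorem Algebra.FormallyUnramified.of_isReduced_of_finrank (K A : Type*) [Field K] [CommRing A]
    [Algebra K A] [Module.Finite K A] [IsReduced A]
    (h : ringChar K = 0 ∨ Module.finrank K A < ringChar K) : Algebra.FormallyUnramified K A := by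
  have : IsArtinianRing A := .of_finite K A
  have hI (I : MaximalSpectrum A) : Algebra.FormallyUnramified K (A ⧸ I.asIdeal) := by
    let : Field (A ⧸ I.asIdeal) := Ideal.Quotient.field I.asIdeal
    have hle : Module.finrank K (A ⧸ I.asIdeal) ≤ Module.finrank K A :=
      LinearMap.finrank_le_finrank_of_surjective (f := (Ideal.Quotient.mkₐ K I.asIdeal).toLinearMap)
        Ideal.Quotient.mk_surjective
    have : Algebra.IsSeparable K (A ⧸ I.asIdeal) :=
      Algebra.isSeparable_of_finrank_lt_ringChar K _ (h.imp_right hle.trans_lt)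
    exact .of_isSeparable K _
  have := (Algebra.FormallyUnramified.pi_iff (R := K)
    fun I : MaximalSpectrum A => A ⧸ I.asIdeal).mpr hI
  exact .of_equiv ((IsArtinianRing.equivPi A).restrictScalars K).symm

/-! ### Elements of the Kähler different from gradients of forms -/

namespace ZeroDimScheme

variable {K : Type*} [Field K] {n : ℕ} (Z : ZeroDimScheme K n)

open TensorProduct

/-- The dehomogenization of the homogeneous component of degree `d` of the Kähler different. -/
def kaehlerImage (d : ℕ) : Submodule K Z.AffineRing where
  carrier := {s | ∃ f ∈ Z.kaehlerDifferent, Z.toTilde f = Polynomial.C s * Polynomial.X ^ d}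
  zero_mem' := ⟨0, zero_mem _, by simp⟩
  add_mem' := by
    rintro s t ⟨f, hf, hfs⟩ ⟨g, hg, hgt⟩
    exact ⟨f + g, add_mem hf hg, by rw [map_add, hfs, hgt, map_add, add_mul]⟩
  smul_mem' := by
    rintro c s ⟨f, hf, hfs⟩
    refine ⟨c • f, ?_, by rw [map_smul, hfs, ← Polynomial.smul_C, smul_mul_assoc]⟩
    rw [Algebra.smul_def]
    exact Ideal.mul_mem_left _ _ hf

/-- The dehomogenized gradients of the forms of degree `d` in the vanishing ideal. -/
def gradients (d : ℕ) : Set (Fin n → Z.AffineRing) :=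
  {v | ∃ F ∈ Z.ideal, F.IsHomogeneous d ∧ v = fun j => Z.ev (pderiv j.succ F)}

theorem det_mem_kaehlerImage {d : Fin n → ℕ} {w : Fin n → Fin n → Z.AffineRing}
    (hw : ∀ i, w i ∈ Z.gradients (d i)) :
    (Matrix.of w).det ∈ Z.kaehlerImage (∑ i, (d i - 1)) := by
  choose F hF hFd hFw using hw
  refine ⟨_, Z.det_jacobian_mem_kaehlerDifferent F hF, ?_⟩
  have hhom : (Matrix.of fun i j : Fin n => pderiv j.succ (F i)).det.IsHomogeneous
      (∑ i, (d i - 1)) := IsHomogeneous.det fun i j => (hFd i).pderiv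
  rw [Z.toTilde_homogeneous hhom, AlgHom.map_det]
  congr 3
  ext i j
  exact (congrFun (hFw i) j).symm

theorem exists_linear_lift (hZ : Z.AvoidsHyperplane) :
    ∃ σ : Z.AffineRing →ₗ[K] MvPolynomial (Fin (n + 1)) K,
      ∀ s, (σ s).IsHomogeneous Z.surjDegree ∧ Z.ev (σ s) = s := by
  let φ := Z.ev.toLinearMap.domRestrict (homogeneousSubmodule (Fin (n + 1)) K Z.surjDegree)
  have hφ : LinearMap.range φ = ⊤ :=
    (LinearMap.range_domRestrict _ _).trans ((formImage_eq_top_iff hZ).mpr le_rfl)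
  obtain ⟨σ, hσ⟩ := φ.exists_rightInverse_of_surjective hφ
  exact ⟨(Submodule.subtype _).comp σ, fun s => ⟨(σ s).2, LinearMap.congr_fun hσ s⟩⟩

/-- With a linear lift `σ` of `S` to forms of degree `r`, the form `X_i σ(s) - X₀ σ(x_i s)` vanishes
in `S`, hence lies in `I`. Here `g j = ev ∘ ∂_j ∘ σ`. -/
theorem exists_separating_gradients (hZ : Z.AvoidsHyperplane) :
    ∃ g : Fin n → Z.AffineRing →ₗ[K] Z.AffineRing, ∀ i s,
      (fun j => (if i = j then s else 0) + Z.ev (X i.succ) * g j s - g j (Z.ev (X i.succ) * s)) ∈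
        Z.gradients (Z.surjDegree + 1) := by
  obtain ⟨σ, hσ⟩ := Z.exists_linear_lift hZ
  refine ⟨fun j => Z.ev.toLinearMap ∘ₗ (pderiv j.succ).toLinearMap ∘ₗ σ, fun i s => ?_⟩
  have hhom : (X i.succ * σ s - X 0 * σ (Z.ev (X i.succ) * s)).IsHomogeneous
      (Z.surjDegree + 1) := by
    have h : ∀ k s, (X k * σ s).IsHomogeneous (Z.surjDegree + 1) := fun k s => by
      rw [mul_comm]
      exact (hσ s).1.mul (isHomogeneous_X K k)
    exact (h _ _).sub (h _ _)
  refine ⟨_, mem_ideal_of_ev_eq_zero hZ hhom ?_, hhom, ?_⟩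
  · rw [map_sub, map_mul, map_mul, (hσ _).2, (hσ _).2, ev_X_zero, one_mul, sub_self]
  · ext j
    have h0 : Z.ev (pderiv j.succ (X 0 * σ (Z.ev (X i.succ) * s))) =
        Z.ev (pderiv j.succ (σ (Z.ev (X i.succ) * s))) := by
      rw [pderiv_mul, pderiv_X_of_ne (Fin.succ_ne_zero j).symm, zero_mul, zero_add, map_mul,
        ev_X_zero, one_mul]
    rw [map_sub, map_sub, h0, pderiv_mul, map_add, map_mul Z.ev, map_mul Z.ev, (hσ s).2, pderiv_X,
      Pi.single_apply]
    simp only [Fin.succ_inj]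
    split_ifs <;> simp

variable {Z}

/-- The previous gradients are linear in `s`, so after tensoring with `S` an element of `S ⊗ S` can
take the place of `s`. For `ε`, the correction `g j (x_i s)` becomes `(x_i ⊗ 1) z_j`, because `id ⊗
g j` is linear over the left factor. -/
theorem exists_separating_rows (hZ : Z.AvoidsHyperplane)
    {ε : Z.AffineRing ⊗[K] Z.AffineRing}
    (hε : ∀ s : Z.AffineRing, (1 ⊗ₜ s) * ε = (s ⊗ₜ 1) * ε) :
    ∃ z : Fin n → Z.AffineRing ⊗[K] Z.AffineRing, ∀ i : Fin n,
      (fun j => (if i = j then ε else 0) +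
        ((1 : Z.AffineRing) ⊗ₜ[K] Z.ev (X i.succ) - Z.ev (X i.succ) ⊗ₜ[K] 1) * z j) ∈
      Submodule.span Z.AffineRing
        ((fun v j => (1 : Z.AffineRing) ⊗ₜ[K] v j) '' Z.gradients (Z.surjDegree + 1)) := by
  obtain ⟨g, hg⟩ := Z.exists_separating_gradients hZ
  refine ⟨fun j => (g j).lTensor Z.AffineRing ε, fun i => ?_⟩
  have key : ∀ η : Z.AffineRing ⊗[K] Z.AffineRing,
      (fun j => (if i = j then η else 0) + (1 ⊗ₜ Z.ev (X i.succ)) * (g j).lTensor Z.AffineRing η -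
        (g j).lTensor Z.AffineRing ((1 ⊗ₜ Z.ev (X i.succ)) * η)) ∈
      Submodule.span Z.AffineRing
        ((fun v j => (1 : Z.AffineRing) ⊗ₜ[K] v j) '' Z.gradients (Z.surjDegree + 1)) := by
    intro η
    induction η using TensorProduct.induction_on with
    | zero =>
      convert Submodule.zero_mem (Submodule.span Z.AffineRing
        ((fun v j => (1 : Z.AffineRing) ⊗ₜ[K] v j) '' Z.gradients (Z.surjDegree + 1))) using 1
      ext j
      simp
    | tmul a b =>
      have h := Submodule.smul_mem (Submodule.span Z.AffineRing
        ((fun v j => (1 : Z.AffineRing) ⊗ₜ[K] v j) '' Z.gradients (Z.surjDegree + 1))) a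
        (Submodule.subset_span ⟨_, hg i b, rfl⟩)
      convert h using 1
      ext j
      rw [Pi.smul_apply, TensorProduct.smul_tmul', smul_eq_mul, mul_one, LinearMap.lTensor_tmul,
        Algebra.TensorProduct.tmul_mul_tmul, Algebra.TensorProduct.tmul_mul_tmul, one_mul,
        LinearMap.lTensor_tmul, TensorProduct.tmul_sub, TensorProduct.tmul_add]
      split_ifs
      · rfl
      · rw [TensorProduct.tmul_zero]
    | add η η' h h' =>
      convert add_mem h h' using 1
      ext j
      simp only [Pi.add_apply, map_add, mul_add]
      split_ifs <;> abel
  have hcomm : ∀ (j : Fin n) (s : Z.AffineRing) (η : Z.AffineRing ⊗[K] Z.AffineRing),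
      (g j).lTensor Z.AffineRing ((s ⊗ₜ 1) * η) = (s ⊗ₜ 1) * (g j).lTensor Z.AffineRing η := by
    intro j s η
    induction η using TensorProduct.induction_on with
    | zero => simp
    | tmul a b => simp
    | add η η' h h' => rw [mul_add, map_add, h, h', map_add, mul_add]
  convert key ε using 1
  ext j
  rw [hε, hcomm]
  ring

/-- For the separability idempotent `ε`, the rows above form `ε` times the identity plus a rank-one
matrix annihilated by `ε`, so their determinant is `ε`. Expanding it puts `ε` in the left `S`-span
of `1 ⊗ W`, with `W` the image in question. A functional `μ` killing `W` then has `(id ⊗ μ)((1 ⊗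
t)ε) = 0` for all `t`, and since `ε` multiplies to `1` this forces `μ = 0`. -/
theorem kaehlerImage_eq_top (hn : 2 ≤ n) (hZ : Z.AvoidsHyperplane)
    [Algebra.FormallyUnramified K Z.AffineRing] :
    Z.kaehlerImage (n * Z.surjDegree) = ⊤ := by
  have := affineRing_finite hZ
  have : Nontrivial (Fin n) := Fin.nontrivial_iff_two_le.mpr hn
  set S := Z.AffineRing
  set ε : S ⊗[K] S := Algebra.FormallyUnramified.elem K S with hεdef
  have hε : ∀ s : S, (1 ⊗ₜ s) * ε = (s ⊗ₜ 1) * ε :=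
    Algebra.FormallyUnramified.one_tmul_mul_elem
  have hlmul : Algebra.TensorProduct.lmul' K ε = 1 := Algebra.FormallyUnramified.lmul_elem
  have hidem : ε * ε = ε := by
    have h : ∀ η : S ⊗[K] S, η * ε = (1 ⊗ₜ Algebra.TensorProduct.lmul' K η) * ε := by
      intro η
      induction η using TensorProduct.induction_on with
      | zero => simp
      | tmul a b =>
        calc (a ⊗ₜ[K] b) * ε = (1 ⊗ₜ b) * ((a ⊗ₜ 1) * ε) := by
              rw [← mul_assoc, Algebra.TensorProduct.tmul_mul_tmul, one_mul, mul_one]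
          _ = _ := by
              rw [← hε, ← mul_assoc, Algebra.TensorProduct.tmul_mul_tmul, one_mul, mul_comm b,
                Algebra.TensorProduct.lmul'_apply_tmul]
      | add η η' h h' => rw [add_mul, h, h', map_add, TensorProduct.tmul_add, add_mul]
    rw [h, hlmul, ← Algebra.TensorProduct.one_def, one_mul]
  obtain ⟨z, hz⟩ := exists_separating_rows hZ hε
  by_contra hW
  obtain ⟨μ, hμ0, hμ⟩ := Submodule.exists_le_ker_of_lt_top _ (lt_top_iff_ne_top.mpr hW)
  let Ψ : S ⊗[K] S →ₗ[S] S :=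
    (Algebra.TensorProduct.rid K S S).toLinearMap ∘ₗ μ.baseChange S
  have hΨt : ∀ a b : S, Ψ (a ⊗ₜ b) = μ b • a := fun a b => by simp [Ψ]
  have hdet := Matrix.det_idempotent_add_vecMulVec hidem
    (fun i : Fin n => (1 : S) ⊗ₜ[K] Z.ev (X i.succ) - Z.ev (X i.succ) ⊗ₜ[K] 1) z
    (fun i => by rw [sub_mul, hε, sub_self])
  have hΨε : Ψ ε = 0 := by
    rw [← LinearMap.mem_ker, ← hdet]
    refine Matrix.det_mem_of_mem_span _ _ ?_ _ hz
    intro w hw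
    choose v hv hvw using hw
    have h1 : (Matrix.of w).det = (1 : S) ⊗ₜ[K] (Matrix.of v).det := by
      change _ = (Algebra.TensorProduct.includeRight : S →ₐ[K] S ⊗[K] S) (Matrix.of v).det
      rw [AlgHom.map_det]
      congr 1
      ext i j
      rw [Matrix.of_apply, ← hvw]
      rfl
    have h2 := hμ (by simpa using Z.det_mem_kaehlerImage hv)
    rw [LinearMap.mem_ker, h1, hΨt, LinearMap.mem_ker.mp h2, zero_smul]
  have hΨ : ∀ t : S, Ψ ((1 ⊗ₜ t) * ε) = 0 := by
    intro t
    have : (t ⊗ₜ[K] (1 : S)) * ε = t • ε := by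
      rw [Algebra.smul_def]; rfl
    rw [hε, this, map_smul, hΨε, smul_zero]
  apply hμ0
  ext t
  -- Writing `ε = ∑ b_i ⊗ c_i` gives `μ(t c_i) = 0` for every `i`, and `t = ∑ t b_i c_i`.
  let b := Module.finBasis K S
  obtain ⟨c, hc⟩ := TensorProduct.eq_repr_basis_left b ε
  rw [Finsupp.sum_fintype _ _ (by simp)] at hc
  have hμc : ∀ t i, μ (t * c i) = 0 := by
    intro t
    have h := hΨ t
    rw [← hc, Finset.mul_sum, map_sum] at h
    simp only [Algebra.TensorProduct.tmul_mul_tmul, one_mul, hΨt] at h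
    exact Fintype.linearIndependent_iff.mp b.linearIndependent _ h
  rw [← hc, map_sum] at hlmul
  simp only [Algebra.TensorProduct.lmul'_apply_tmul] at hlmul
  rw [← mul_one t, ← hlmul, Finset.mul_sum, map_sum]
  refine Finset.sum_eq_zero fun i _ => ?_
  rw [← mul_assoc]
  exact hμc _ _

theorem exists_pderiv_notMem (hZ : Z.AvoidsHyperplane)
    (hchar : ringChar K = 0 ∨ Z.degree < ringChar K) (h : ¬ Z.NoFormsUpToSurjDegree) :
    ∃ α, 1 ≤ α ∧ α ≤ Z.surjDegree ∧ ∃ F ∈ Z.ideal, F.IsHomogeneous α ∧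
      ∃ k : Fin n, pderiv k.succ F ∉ Z.ideal := by
  classical
  have hex : ∃ j ≤ Z.surjDegree, ∃ F ∈ Z.ideal, F.IsHomogeneous j ∧ F ≠ 0 := by
    unfold NoFormsUpToSurjDegree at h
    push Not at h
    exact h
  have hex' : ∃ j, ∃ F ∈ Z.ideal, F.IsHomogeneous j ∧ F ≠ 0 :=
    let ⟨j, _, h⟩ := hex; ⟨j, h⟩
  obtain ⟨F, hF, hFα, hF0⟩ := Nat.find_spec hex'
  set α := Nat.find hex' with hα
  have hmin : ∀ j < α, ∀ G ∈ Z.ideal, G.IsHomogeneous j → G = 0 := by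
    intro j hj G hG hGj
    by_contra hG0
    exact Nat.find_min hex' hj ⟨G, hG, hGj, hG0⟩
  have hαr : α ≤ Z.surjDegree := by
    obtain ⟨j, hj, hj'⟩ := hex
    exact (Nat.find_min' hex' hj').trans hj
  have hα1 : 1 ≤ α := by
    by_contra h0
    rw [show α = 0 by omega, ← totalDegree_zero_iff_isHomogeneous,
      totalDegree_eq_zero_iff_eq_C] at hFα
    refine ideal_ne_top (Z := Z) (Ideal.eq_top_of_isUnit_mem _ hF ?_)
    rw [hFα] at hF0 ⊢
    exact (isUnit_iff_ne_zero.mpr fun h => hF0 (by rw [h, map_zero])).map C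
  refine ⟨α, hα1, hαr, F, hF, hFα, ?_⟩
  by_contra hall
  push Not at hall
  have hzero : ∀ j : Fin (n + 1), pderiv j F ∈ Z.ideal → pderiv j F = 0 := fun j hj =>
    hmin (α - 1) (by omega) _ hj hFα.pderiv
  have heuler := hFα.sum_X_mul_pderiv
  rw [Fin.sum_univ_succ, Finset.sum_eq_zero fun k _ => by rw [hzero _ (hall k), mul_zero],
    add_zero] at heuler
  -- Euler's formula has been reduced to `X₀ ∂₀F = αF ∈ I`, and `X₀` can be cancelled modulo `I`.
  have h0 : pderiv 0 F = 0 := by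
    refine hzero 0 (mem_of_X_zero_mul_mem hZ ?_)
    rw [heuler]
    exact nsmul_mem hF α
  rw [h0, mul_zero, ← Nat.cast_smul_eq_nsmul K, eq_comm, smul_eq_zero] at heuler
  have hcast := heuler.resolve_right hF0
  rw [ringChar.spec] at hcast
  rcases hchar with hc | hc
  · rw [hc, zero_dvd_iff] at hcast
    omega
  · have := Nat.le_of_dvd hα1 hcast
    have := surjDegree_lt_degree hZ
    omega

theorem exists_kaehlerImage_ne_bot (hZ : Z.AvoidsHyperplane)
    [Algebra.FormallyUnramified K Z.AffineRing]
    (hchar : ringChar K = 0 ∨ Z.degree < ringChar K) (h : ¬ Z.NoFormsUpToSurjDegree) :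
    ∃ d < n * Z.surjDegree, Z.kaehlerImage d ≠ ⊥ := by
  have := affineRing_finite hZ
  obtain ⟨α, hα1, hαr, F, hF, hFα, k, hk⟩ := exists_pderiv_notMem hZ hchar h
  set S := Z.AffineRing
  obtain ⟨z, hz⟩ := exists_separating_rows hZ
    (Algebra.FormallyUnramified.one_tmul_mul_elem (R := K) (S := S))
  -- Multiplication `S ⊗ S → S` sends `ε` to `1` and kills `1 ⊗ x_i - x_i ⊗ 1`, so the separating
  -- rows become unit vectors.
  have hrow : ∀ i : Fin n, (fun j => if i = j then (1 : S) else 0) ∈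
      Submodule.span S (Z.gradients (Z.surjDegree + 1)) := by
    intro i
    let L : (Fin n → S ⊗[K] S) →ₗ[S] (Fin n → S) :=
      (Algebra.TensorProduct.lmul'' K : S ⊗[K] S →ₐ[S] S).toLinearMap.compLeft (Fin n)
    have h1 := Submodule.mem_map_of_mem (f := L) (hz i)
    rw [Submodule.map_span, Set.image_image] at h1
    have h5 : (fun v : Fin n → S => L fun j => (1 : S) ⊗ₜ[K] v j) = id := by
      ext v j
      exact (Algebra.TensorProduct.lmul'_apply_tmul (R := K) 1 (v j)).trans (one_mul _)
    rw [h5, Set.image_id] at h1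
    convert h1 using 1
    ext j
    have h2 : Algebra.TensorProduct.lmul' K (Algebra.FormallyUnramified.elem K S) = 1 :=
      Algebra.FormallyUnramified.lmul_elem
    have h3 : ∀ η : S ⊗[K] S, Algebra.TensorProduct.lmul'' K η =
      Algebra.TensorProduct.lmul' K η := fun η => rfl
    have h4 : L (fun j => (if i = j then Algebra.FormallyUnramified.elem K S else 0) +
        ((1 : S) ⊗ₜ[K] Z.ev (X i.succ) - Z.ev (X i.succ) ⊗ₜ[K] 1) * z j) j =
        Algebra.TensorProduct.lmul' K ((if i = j then Algebra.FormallyUnramified.elem K S else 0) +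
          ((1 : S) ⊗ₜ[K] Z.ev (X i.succ) - Z.ev (X i.succ) ⊗ₜ[K] 1) * z j) := rfl
    rw [h4, map_add, map_mul, map_sub]
    simp only [Algebra.TensorProduct.lmul'_apply_tmul, one_mul, mul_one, sub_self, zero_mul,
      add_zero]
    split_ifs
    · exact h2.symm
    · rw [map_zero]
  let d : Fin n → ℕ := fun i => if i = k then α else Z.surjDegree + 1
  have hd : ∑ i, (d i - 1) < n * Z.surjDegree := by
    have h1 : ∑ i, (d i - 1) < ∑ _i : Fin n, Z.surjDegree := by
      refine Finset.sum_lt_sum (fun i _ => ?_) ⟨k, Finset.mem_univ _, ?_⟩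
      · simp only [d]
        split_ifs <;> omega
      · simp only [d, if_true]
        omega
    simpa using h1
  refine ⟨_, hd, fun hbot => hk (mem_ideal_of_ev_eq_zero hZ hFα.pderiv ?_)⟩
  let v : Fin n → S := fun j => Z.ev (pderiv j.succ F)
  -- This determinant is `∂F/∂X_k` in `S`; it is an `S`-combination of Jacobian determinants that
  -- would all vanish.
  have hdet : (Matrix.of ((1 : Matrix (Fin n) (Fin n) S).updateRow k v)).det ∈ (⊥ : Ideal S) := by
    refine Matrix.det_mem_of_mem_span (fun i => Z.gradients (d i)) _ ?_ _ ?_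
    · intro w hw
      have h1 := Z.det_mem_kaehlerImage hw
      rw [hbot, Submodule.mem_bot] at h1
      rw [h1]
      exact zero_mem _
    · intro i
      by_cases hik : i = k
      · subst hik
        rw [Matrix.updateRow_self]
        exact Submodule.subset_span ⟨F, hF, by simpa [d] using hFα, rfl⟩
      · rw [Matrix.updateRow_ne hik]
        simp only [d, if_neg hik]
        convert hrow i using 1
        ext j
        rw [Matrix.one_apply]
  exact (Matrix.det_updateRow_one k v).symm.trans hdet

end ZeroDimScheme

/-! ### Reduced Artinian rings -/

theorem IsArtinianRing.eq_zero_of_forall_mem {A : Type*} [CommRing A] [IsArtinianRing A]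
    [IsReduced A] {a : A} (h : ∀ q : MaximalSpectrum A, a ∈ q.asIdeal) : a = 0 := by
  apply (IsArtinianRing.equivPi A).injective
  ext q
  rw [IsArtinianRing.equivPi_apply, map_zero, Pi.zero_apply]
  exact Ideal.Quotient.eq_zero_iff_mem.mpr (h q)

theorem IsArtinianRing.exists_indicator {A : Type*} [CommRing A] [IsArtinianRing A]
    [IsReduced A] (p : MaximalSpectrum A) :
    ∃ e : A, 1 - e ∈ p.asIdeal ∧ ∀ q : MaximalSpectrum A, q ≠ p → e ∈ q.asIdeal := by
  classical
  have h := (IsArtinianRing.equivPi A).apply_symm_apply (Pi.single p 1)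
  refine ⟨(IsArtinianRing.equivPi A).symm (Pi.single p 1), ?_, fun q hq => ?_⟩
  · have hp := congrFun h p
    rw [← Ideal.Quotient.eq_zero_iff_mem, map_sub, map_one]
    rw [IsArtinianRing.equivPi_apply, Pi.single_eq_same] at hp
    exact sub_eq_zero.mpr hp.symm
  · have hp := congrFun h q
    rw [← Ideal.Quotient.eq_zero_iff_mem]
    rwa [IsArtinianRing.equivPi_apply, Pi.single_eq_of_ne hq] at hp

namespace ZeroDimScheme

variable {K : Type*} [Field K] {n : ℕ} {Z : ZeroDimScheme K n}

/-! ### The ideals `⨁_{j ≥ i} Rⱼ` -/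

theorem toTilde_x_zero : Z.toTilde (Z.x 0) = Polynomial.X := by
  rw [x, Z.toTilde_homogeneous (isHomogeneous_X K 0), ev_X_zero, map_one, one_mul, pow_one]

theorem exists_toTilde_eq (hZ : Z.AvoidsHyperplane) {d : ℕ} (hd : Z.surjDegree ≤ d)
    (s : Z.AffineRing) : ∃ f, Z.toTilde f = Polynomial.C s * Polynomial.X ^ d :=
  Z.C_mul_X_pow_mem_range.mpr (mem_formImage_of_le hZ hd s)

theorem tailIdeal_le (hZ : Z.AvoidsHyperplane) {i : ℕ} {𝔟 : Ideal Z.CoordRing}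
    (h : ∀ d, i ≤ d → ∀ s, ∃ g ∈ 𝔟, Z.toTilde g = Polynomial.C s * Polynomial.X ^ d) :
    Z.tailIdeal i ≤ 𝔟 := by
  intro f hf
  rw [mem_tailIdeal, Polynomial.X_pow_dvd_iff] at hf
  have hd : ∀ d ∈ (Z.toTilde f).support, i ≤ d := by
    intro d hd
    by_contra hlt
    exact Polynomial.mem_support_iff.mp hd (hf d (not_le.mp hlt))
  choose! g hg hgf using h
  have hsum : f = ∑ d ∈ (Z.toTilde f).support, g d ((Z.toTilde f).coeff d) := by
    apply toTilde_injective hZ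
    rw [map_sum]
    conv_lhs => rw [(Z.toTilde f).as_sum_support_C_mul_X_pow]
    exact Finset.sum_congr rfl fun d hds => (hgf d (hd d hds) _).symm
  rw [hsum]
  exact sum_mem fun d hds => hg d (hd d hds) _

/-- For `d ≥ nr`, split `s x₀^d` as `(x₀^r)^{n-1} · s x₀^{d-(n-1)r}`; the last factor is in `R`
since its degree is at least `r`. -/
theorem tailIdeal_surjDegree_pow (hn : n ≠ 0) (hZ : Z.AvoidsHyperplane) :
    Z.tailIdeal Z.surjDegree ^ n = Z.tailIdeal (n * Z.surjDegree) := by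
  refine le_antisymm (Z.tailIdeal_pow_le _ _) (tailIdeal_le hZ fun d hd s => ?_)
  obtain ⟨m, rfl⟩ := Nat.exists_eq_succ_of_ne_zero hn
  rw [Nat.succ_mul] at hd
  obtain ⟨g, hg⟩ := exists_toTilde_eq hZ (by omega : Z.surjDegree ≤ d - m * Z.surjDegree) s
  refine ⟨(Z.x 0 ^ Z.surjDegree) ^ m * g, ?_, ?_⟩
  · rw [pow_succ]
    refine Ideal.mul_mem_mul (Ideal.pow_mem_pow ?_ _) ?_
    · rw [mem_tailIdeal, map_pow, toTilde_x_zero]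
    · rw [mem_tailIdeal, hg]
      exact Dvd.dvd.mul_left (pow_dvd_pow _ (by omega)) _
  · rw [map_mul, map_pow, map_pow, toTilde_x_zero, hg, ← pow_mul, mul_left_comm, ← pow_add]
    congr 2
    rw [mul_comm]
    omega

theorem kaehlerDifferent_eq_tailIdeal (hn : 2 ≤ n) (hZ : Z.AvoidsHyperplane)
    [Algebra.FormallyUnramified K Z.AffineRing] (h : Z.NoFormsUpToSurjDegree) :
    Z.kaehlerDifferent = Z.tailIdeal (n * Z.surjDegree) := by
  refine le_antisymm (Z.kaehlerDifferent_le_tailIdeal h) (tailIdeal_le hZ fun d hd s => ?_)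
  have hs : s ∈ Z.kaehlerImage (n * Z.surjDegree) := by
    rw [kaehlerImage_eq_top hn hZ]
    trivial
  obtain ⟨f, hf, hfs⟩ := hs
  refine ⟨Z.x 0 ^ (d - n * Z.surjDegree) * f, Ideal.mul_mem_left _ _ hf, ?_⟩
  rw [map_mul, map_pow, toTilde_x_zero, hfs, mul_left_comm, ← pow_add, Nat.sub_add_cancel hd]

theorem idealHilbertFn_natCast (hZ : Z.AvoidsHyperplane) (𝔞 : Ideal Z.CoordRing) (d : ℕ) :
    Z.idealHilbertFn 𝔞 d = Module.finrank K
      ((𝔞.restrictScalars K ⊓ Z.component d : Submodule K Z.CoordRing).map Z.deh.toLinearMap) :=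
  (finrank_map_deh hZ inf_le_right).symm

theorem idealHilbertFn_tailIdeal (hZ : Z.AvoidsHyperplane) {m : ℕ} (hm : Z.surjDegree ≤ m)
    (i : ℤ) : Z.idealHilbertFn (Z.tailIdeal m) i = if i < m then 0 else Z.degree := by
  rcases lt_or_ge i 0 with hi | hi
  · rw [if_pos (by omega), idealHilbertFn, Z.component_of_neg hi, inf_bot_eq, finrank_bot]
  lift i to ℕ using hi
  rw [idealHilbertFn_natCast hZ]
  split_ifs with him
  · refine (congrArg (fun N : Submodule K Z.AffineRing => Module.finrank K N) ?_).trans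
      (finrank_bot K Z.AffineRing)
    rw [eq_bot_iff]
    rintro _ ⟨f, ⟨hf, hfi⟩, rfl⟩
    have h1 := Z.mem_tailIdeal.mp hf
    rw [Z.toTilde_of_mem_component hfi, Polynomial.X_pow_dvd_iff] at h1
    simpa using h1 i (by omega)
  · refine (congrArg (fun N : Submodule K Z.AffineRing => Module.finrank K N) ?_).trans
      (finrank_top K Z.AffineRing)
    rw [eq_top_iff]
    intro s _
    obtain ⟨F, hF, rfl⟩ := mem_formImage_of_le hZ (i := i) (by omega) s
    refine ⟨Z.toCoord F, ⟨Z.toCoord_mem_tailIdeal (by omega) hF, ?_⟩, rfl⟩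
    rw [component_natCast]
    exact ⟨F, hF, rfl⟩

theorem noFormsUpToSurjDegree_of_idealHilbertFn_eq_zero (hZ : Z.AvoidsHyperplane)
    [Algebra.FormallyUnramified K Z.AffineRing]
    (hchar : ringChar K = 0 ∨ Z.degree < ringChar K)
    (h : ∀ d : ℕ, d < n * Z.surjDegree → Z.idealHilbertFn Z.kaehlerDifferent d = 0) :
    Z.NoFormsUpToSurjDegree := by
  have := affineRing_finite hZ
  by_contra hno
  obtain ⟨d, hd, hne⟩ := exists_kaehlerImage_ne_bot hZ hchar hno
  have h0 := h d hd
  rw [idealHilbertFn_natCast hZ, Submodule.finrank_eq_zero] at h0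
  refine hne (eq_bot_iff.mpr ?_)
  rintro s ⟨f, hf, hfs⟩
  obtain ⟨hfd, rfl⟩ := mem_component_of_toTilde hZ hfs
  rw [← h0]
  exact ⟨f, ⟨hf, hfd⟩, rfl⟩

/-! ### The Cayley-Bacharach property -/

theorem sepDegree_le_iff (hZ : Z.AvoidsHyperplane) {a : Z.AffineRing} {i : ℕ} :
    Z.sepDegree a ≤ i ↔ a ∈ Z.formImage i := by
  constructor
  · intro h
    have h1 : Z.sepDegree a ∈
        {i : ℕ | Polynomial.C a * Polynomial.X ^ i ∈ Set.range Z.toTilde} :=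
      Nat.sInf_mem ⟨_, exists_toTilde_eq hZ le_rfl a⟩
    exact Z.formImage_mono h (Z.C_mul_X_pow_mem_range.mp h1)
  · intro h
    exact Nat.sInf_le (Z.C_mul_X_pow_mem_range.mpr h)

theorem exists_isMaxSepDegree_le (hZ : Z.AvoidsHyperplane) (p : MaximalSpectrum Z.AffineRing)
    {e : Z.AffineRing} {i : ℕ} (h : ∀ a, a * e ∈ Z.formImage i) :
    ∃ d ≤ i, Z.IsMaxSepDegree p (Ideal.span {e}) d := by
  have := affineRing_finite hZ
  let b := Module.finBasis K (Z.AffineRing ⧸ p.asIdeal)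
  choose c hc using fun k => Ideal.Quotient.mk_surjective (I := p.asIdeal) (b k)
  refine ⟨_, ?_, e, _, c, b, rfl, fun k => (hc k).symm, rfl⟩
  exact Finset.sup_le fun k _ => (sepDegree_le_iff hZ).mpr (h _)

section

variable [IsArtinianRing Z.AffineRing] [IsReduced Z.AffineRing]

theorem mul_eq_zero_of_mem {p : MaximalSpectrum Z.AffineRing} {e : Z.AffineRing}
    (he : ∀ q : MaximalSpectrum Z.AffineRing, q ≠ p → e ∈ q.asIdeal) {a : Z.AffineRing}
    (ha : a ∈ p.asIdeal) : a * e = 0 := by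
  refine IsArtinianRing.eq_zero_of_forall_mem fun q => ?_
  by_cases hq : q = p
  · exact hq ▸ Ideal.mul_mem_right _ _ ha
  · exact Ideal.mul_mem_left _ _ (he q hq)

/-- Multiplication by `e` has kernel `p` and image `⟨e⟩`, which gives the degree count. -/
theorem isMaximalPSubscheme_span (hZ : Z.AvoidsHyperplane) {p : MaximalSpectrum Z.AffineRing}
    {e : Z.AffineRing} (hep : 1 - e ∈ p.asIdeal)
    (he : ∀ q : MaximalSpectrum Z.AffineRing, q ≠ p → e ∈ q.asIdeal) :
    Z.IsMaximalPSubscheme p (Ideal.span {e}) := by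
  have := affineRing_finite hZ
  have hzero : (1 - e) * e = 0 := mul_eq_zero_of_mem he hep
  refine ⟨⟨fun h => ?_, fun q hq => ?_⟩, ?_⟩
  · rw [Ideal.map_span, Set.image_singleton, Ideal.span_singleton_eq_bot,
      IsLocalization.map_eq_zero_iff p.asIdeal.primeCompl] at h
    obtain ⟨t, ht⟩ := h
    refine t.2 ?_
    have : (t : Z.AffineRing) = t * (1 - e) := by rw [mul_sub, ht, mul_one, sub_zero]
    rw [this]
    exact Ideal.mul_mem_left _ _ hep
  · rw [Ideal.map_span, Set.image_singleton, Ideal.span_singleton_eq_bot,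
      IsLocalization.map_eq_zero_iff q.asIdeal.primeCompl]
    refine ⟨⟨1 - e, fun h => q.isMaximal.ne_top ?_⟩, hzero⟩
    rw [Ideal.eq_top_iff_one]
    simpa using add_mem h (he q hq)
  · let φ : Z.AffineRing →ₗ[K] Z.AffineRing := LinearMap.mulRight K e
    have hker : LinearMap.ker φ = p.asIdeal.restrictScalars K := by
      ext a
      rw [LinearMap.mem_ker, LinearMap.mulRight_apply, Submodule.restrictScalars_mem]
      refine ⟨fun h => ?_, mul_eq_zero_of_mem he⟩
      have : a = a * (1 - e) := by rw [mul_sub, h, mul_one, sub_zero]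
      rw [this]
      exact Ideal.mul_mem_left _ _ hep
    have hrange : LinearMap.range φ = (Ideal.span {e}).restrictScalars K := by
      ext a
      rw [Submodule.restrictScalars_mem, Ideal.mem_span_singleton']
      rfl
    have h1 := Submodule.finrank_quotient_add_finrank ((Ideal.span {e}).restrictScalars K)
    have h2 := Submodule.finrank_quotient_add_finrank (p.asIdeal.restrictScalars K)
    have h3 := φ.finrank_range_add_finrank_ker
    rw [hker, hrange] at h3
    change Module.finrank K (Z.AffineRing ⧸ Ideal.span {e}) + _ = _ at h1
    change Module.finrank K (Z.AffineRing ⧸ p.asIdeal) + _ = _ at h2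
    unfold degree
    omega

theorem pointDegree_le (hZ : Z.AvoidsHyperplane) {p : MaximalSpectrum Z.AffineRing}
    {e : Z.AffineRing} (hep : 1 - e ∈ p.asIdeal)
    (he : ∀ q : MaximalSpectrum Z.AffineRing, q ≠ p → e ∈ q.asIdeal) {i : ℕ}
    (h : ∀ a, a * e ∈ Z.formImage i) : Z.pointDegree p ≤ i := by
  obtain ⟨d, hd, hmax⟩ := exists_isMaxSepDegree_le hZ p h
  exact (Nat.sInf_le ⟨_, isMaximalPSubscheme_span hZ hep he, hmax⟩ : Z.pointDegree p ≤ d).trans hd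

theorem exists_isMaximalPSubscheme_pointDegree (hZ : Z.AvoidsHyperplane)
    (p : MaximalSpectrum Z.AffineRing) :
    ∃ J, Z.IsMaximalPSubscheme p J ∧ Z.IsMaxSepDegree p J (Z.pointDegree p) := by
  obtain ⟨e, hep, he⟩ := IsArtinianRing.exists_indicator p
  obtain ⟨d, -, hmax⟩ := exists_isMaxSepDegree_le hZ p (e := e)
    fun a => mem_formImage_of_le hZ le_rfl _
  exact Nat.sInf_mem (s := {d | ∃ J, Z.IsMaximalPSubscheme p J ∧ Z.IsMaxSepDegree p J d})
    ⟨d, _, isMaximalPSubscheme_span hZ hep he, hmax⟩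

/-- A separator `s` vanishes at all points other than `p`, so reducedness makes `p` annihilate it.
Thus `a s` depends only on `a` modulo `p` and is a `K`-combination of the `e_k s`. -/
theorem exists_ne_zero_of_isMaxSepDegree (hZ : Z.AvoidsHyperplane)
    {p : MaximalSpectrum Z.AffineRing} {J : Ideal Z.AffineRing} {d : ℕ}
    (hJ : Z.IsPSubscheme p J) (hd : Z.IsMaxSepDegree p J d) :
    ∃ s ≠ 0, ∀ a, a * s ∈ Z.formImage d := by
  obtain ⟨s, κ, e, b, rfl, hb, rfl⟩ := hd
  refine ⟨s, ?_, fun a => ?_⟩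
  · rintro rfl
    exact hJ.1 (by simp)
  have hs : ∀ q : MaximalSpectrum Z.AffineRing, q ≠ p → s ∈ q.asIdeal := by
    intro q hq
    have h := hJ.2 q hq
    rw [Ideal.map_span, Set.image_singleton, Ideal.span_singleton_eq_bot,
      IsLocalization.map_eq_zero_iff q.asIdeal.primeCompl] at h
    obtain ⟨t, ht⟩ := h
    exact (q.isMaximal.isPrime.mem_or_mem (ht ▸ zero_mem _ : (t : Z.AffineRing) * s ∈ q.asIdeal)
      ).resolve_left t.2
  have ha : a - ∑ k, b.repr (Ideal.Quotient.mk p.asIdeal a) k • e k ∈ p.asIdeal := by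
    rw [← Ideal.Quotient.eq_zero_iff_mem, map_sub, map_sum, sub_eq_zero]
    conv_lhs => rw [← b.sum_repr (Ideal.Quotient.mk p.asIdeal a)]
    refine Finset.sum_congr rfl fun k _ => ?_
    rw [hb]
    rfl
  have h0 := mul_eq_zero_of_mem hs ha
  rw [sub_mul, sub_eq_zero, Finset.sum_mul] at h0
  rw [h0]
  refine sum_mem fun k _ => ?_
  rw [smul_mul_assoc]
  exact Submodule.smul_mem _ _ ((sepDegree_le_iff hZ).mp
    (Finset.le_sup (f := fun k => Z.sepDegree (e k * s)) (Finset.mem_univ k)))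

/-- A coefficient `s` in degree `i` of a conductor element satisfies `s S ⊆ V_i`. If `s` is nonzero
at `p`, the indicator of `p` is a multiple of `s`, so `p` has degree at most `i`; hence `i ≥ r`. -/
theorem conductor_eq_tailIdeal (hZ : Z.AvoidsHyperplane) (hCB : Z.IsCayleyBacharach) :
    Z.conductor = Z.tailIdeal Z.surjDegree := by
  apply le_antisymm
  · intro f hf
    rw [mem_tailIdeal, Polynomial.X_pow_dvd_iff]
    intro i hi
    set s := (Z.toTilde f).coeff i with hs
    have hst : ∀ t, s * t ∈ Z.formImage i := by
      intro t
      have h := Z.mem_range_toTilde.mp (hf (Polynomial.C t)) i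
      rwa [Polynomial.coeff_mul_C] at h
    refine IsArtinianRing.eq_zero_of_forall_mem fun p => ?_
    by_contra hsp
    obtain ⟨e, hep, he⟩ := IsArtinianRing.exists_indicator p
    obtain ⟨t, ht⟩ := p.isMaximal.exists_inv hsp
    obtain ⟨y, hy, hty⟩ := ht
    have hle : Z.pointDegree p ≤ i := by
      refine pointDegree_le hZ hep he fun a => ?_
      have h0 : y * e = 0 := mul_eq_zero_of_mem he hy
      have h1 : a * e = s * (t * e * a) := by
        linear_combination (-(a * e)) * hty + a * h0
      rw [h1]
      exact hst _
    have := hCB p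
    rw [regIndex_eq hZ] at this
    omega
  · intro f hf g
    rw [mem_tailIdeal, Polynomial.X_pow_dvd_iff] at hf
    rw [mem_range_toTilde]
    intro i
    rcases le_or_gt Z.surjDegree i with hi | hi
    · exact mem_formImage_of_le hZ hi _
    · rw [Polynomial.coeff_mul, Finset.sum_eq_zero]
      · exact zero_mem _
      · intro m hm
        rw [hf m.1 (by have := Finset.HasAntidiagonal.mem_antidiagonal.mp hm; omega), zero_mul]

end

/-- Lift `s ∈ J` and `x_j s` to forms `F`, `F'` of degree `d`. Then `F X_j - F' X₀` is in `I` with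
degree `d + 1 ≤ r`, so it is zero and `X₀` divides `F`. Thus `J` lies in the image of forms one
degree lower, and descent ends with `J = 0`. -/
theorem eq_zero_of_forall_mul_mem_formImage (hn : n ≠ 0) (hZ : Z.AvoidsHyperplane)
    (h : Z.NoFormsUpToSurjDegree) (d : ℕ) (hd : d < Z.surjDegree) :
    ∀ J : Ideal Z.AffineRing, (∀ s ∈ J, s ∈ Z.formImage d) → J = ⊥ := by
  obtain ⟨j, hj⟩ : ∃ j : Fin (n + 1), j ≠ 0 := ⟨Fin.last n, by simpa [Fin.ext_iff] using hn⟩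
  have key : ∀ d < Z.surjDegree, ∀ J : Ideal Z.AffineRing, (∀ s ∈ J, s ∈ Z.formImage d) →
      ∀ s ∈ J, ∃ H : MvPolynomial (Fin (n + 1)) K,
        Polynomial.C s * Polynomial.X ^ d = Polynomial.X * Z.toTilde (Z.toCoord H) := by
    intro d hd J hJ s hs
    obtain ⟨F, hF, rfl⟩ := Z.mem_formImage.mp (hJ s hs)
    obtain ⟨F', hF', hFF'⟩ := Z.mem_formImage.mp (hJ _ (Ideal.mul_mem_left J (Z.ev (X j)) hs))
    have hhom : (F * X j - F' * X 0).IsHomogeneous (d + 1) :=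
      (hF.mul (isHomogeneous_X K j)).sub (hF'.mul (isHomogeneous_X K 0))
    have h0 := h (d + 1) hd _ (mem_ideal_of_ev_eq_zero hZ hhom (by
      rw [map_sub, map_mul, map_mul, hFF', ev_X_zero, mul_one, mul_comm, sub_self])) hhom
    have hdvd : (X 0 : MvPolynomial (Fin (n + 1)) K) ∣ F := by
      have h1 : (X 0 : MvPolynomial (Fin (n + 1)) K) ∣ F * X j := by
        rw [sub_eq_zero.mp h0]
        exact Dvd.intro_left _ rfl
      refine (X_prime.dvd_or_dvd h1).resolve_right fun h2 => hj ?_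
      exact (X_dvd_X.mp h2).symm
    obtain ⟨H, rfl⟩ := hdvd
    refine ⟨H, ?_⟩
    rw [← Z.toTilde_homogeneous hF, map_mul, map_mul]
    exact congrArg (· * _) toTilde_x_zero
  induction d with
  | zero =>
    intro J hJ
    rw [eq_bot_iff]
    intro s hs
    obtain ⟨H, hH⟩ := key 0 hd J hJ s hs
    simpa using congrArg (fun g => g.coeff 0) hH
  | succ d ih =>
    intro J hJ
    refine ih (by omega) J fun s hs => ?_
    obtain ⟨H, hH⟩ := key (d + 1) hd J hJ s hs
    have hc := congrArg (fun g => g.coeff (d + 1)) hH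
    simp only [Polynomial.coeff_X_mul, coeff_toTilde, Polynomial.coeff_C_mul_X_pow, if_true] at hc
    exact ⟨_, homogeneousComponent_isHomogeneous d H, hc.symm⟩

theorem isCayleyBacharach_of_noForms (hn : n ≠ 0) (hZ : Z.AvoidsHyperplane) (hred : Z.Reduced)
    (h : Z.NoFormsUpToSurjDegree) : Z.IsCayleyBacharach := by
  have := affineRing_finite hZ
  have : IsArtinianRing Z.AffineRing := .of_finite K _
  have : IsReduced Z.AffineRing := hred
  intro p
  rw [regIndex_eq hZ, Nat.cast_inj]
  apply le_antisymm
  · obtain ⟨e, hep, he⟩ := IsArtinianRing.exists_indicator p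
    exact pointDegree_le hZ hep he fun a => mem_formImage_of_le hZ le_rfl _
  · by_contra hlt
    obtain ⟨J, hJ, hd⟩ := exists_isMaximalPSubscheme_pointDegree hZ p
    obtain ⟨s, hs0, hs⟩ := exists_ne_zero_of_isMaxSepDegree hZ hJ.1 hd
    have hbot := eq_zero_of_forall_mul_mem_formImage hn hZ h _ (not_le.mp hlt) (Ideal.span {s})
      fun t ht => by
        obtain ⟨a, rfl⟩ := Ideal.mem_span_singleton'.mp ht
        exact hs a
    exact hs0 (Ideal.span_singleton_eq_bot.mp hbot)

end ZeroDimScheme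

end

theorem proposition3p4 {K : Type*} [Field K] {n : ℕ} (hn : 2 ≤ n) (Z : ZeroDimScheme K n)
    (hchar : ringChar K = 0 ∨ Z.degree < ringChar K) (hZ : Z.AvoidsHyperplane)
    (hred : Z.Reduced) :
    List.TFAE
      [Z.GenericPosition ∧ Z.degree = (n + Z.initialDegree - 1).choose n,
       ∀ i : ℤ, Z.idealHilbertFn Z.kaehlerDifferent i =
         if i < n * Z.regIndex then 0 else Z.degree,
       Z.IsCayleyBacharach ∧ Z.kaehlerDifferent = Z.conductor ^ n] := by
  have := ZeroDimScheme.affineRing_finite hZ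
  have : IsArtinianRing Z.AffineRing := .of_finite K _
  have : IsReduced Z.AffineRing := hred
  have := Algebra.FormallyUnramified.of_isReduced_of_finrank K Z.AffineRing hchar
  have hn0 : n ≠ 0 := by omega
  rw [ZeroDimScheme.genericPosition_and_iff hn hZ, ZeroDimScheme.regIndex_eq hZ]
  have hcond : Z.IsCayleyBacharach → Z.conductor ^ n = Z.tailIdeal (n * Z.surjDegree) :=
    fun hCB => by
      rw [ZeroDimScheme.conductor_eq_tailIdeal hZ hCB,
        ZeroDimScheme.tailIdeal_surjDegree_pow hn0 hZ]
  tfae_have 1 → 3 := fun h => by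
    have hCB := ZeroDimScheme.isCayleyBacharach_of_noForms hn0 hZ hred h
    exact ⟨hCB, by rw [hcond hCB, ZeroDimScheme.kaehlerDifferent_eq_tailIdeal hn hZ h]⟩
  tfae_have 3 → 2 := by
    rintro ⟨hCB, h⟩ i
    -- The side condition is `r ≤ nr`: beyond `nr` the forms must already fill `S`.
    rw [h, hcond hCB, ZeroDimScheme.idealHilbertFn_tailIdeal hZ
      (Nat.le_mul_of_pos_left _ (by omega)), Nat.cast_mul]
  tfae_have 2 → 1 := fun h =>
    ZeroDimScheme.noFormsUpToSurjDegree_of_idealHilbertFn_eq_zero hZ hchar fun d hd => by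
      rw [h, if_pos (by exact_mod_cast hd)]
  tfae_finish
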